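/- **Setting.** Let $f,g:\mathbb R^p\times\mathbb R^q\to\mathbb R$ ($q\ge 1$), $f$ of class $C^1$ and $g$ of class $C^2$. Assume that there are constants $L_x,L_{xy},L_y,\widetilde L_{xy},\widetilde L_y,\rho_{xy},\rho_{yy}\ge 0$ and $\mu_y>0$ such that $\nabla_x f$ is $L_x$-Lipschitz in $x$ and $L_{xy}$-Lipschitz in $y$; $\nabla_y f$ is $L_{xy}$-Lipschitz in $x$ and $L_y$-Lipschitz in $y$; $\nabla_y g$ is $\widetilde L_{xy}$-Lipschitz in $x$ and $\widetilde L_y$-Lipschitz in $y$; $\nabla_x\nabla_y g$ is $\rho_{xy}$-Lipschitz and $\nabla_y^2 g$ is $\rho_{yy}$-Lipschitz in $(x,y)$ (spectral norm, Euclidean norm of $(x,y)$); every $g(x,\cdot)$ is $\mu_y$-strongly convex, with minimizer $y^*(x)$; and $\Phi(x)=f(x,y^*(x))$ is convex. Let $x^*$ be a minimizer of $\Phi$ with $\|x^*\|=B>0$. No bound on $\nabla_y f$ is assumed. **Algorithm AccBiO** for an outer function $F$, with parameters $L,\mu>0$ and $N,M\in\mathbb N$. Put $\kappa_y=\widetilde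 L_y/\mu_y$, $\kappa=L/\mu$, $\lambda=4/(\sqrt{\widetilde L_y}+\sqrt{\mu_y})^2$, $\theta=\max\{(1-\sqrt{\lambda\mu_y})^2,(1-\sqrt{\lambda\widetilde L_y})^2\}$ and $z_0=x_0=0$. Iteration $k=0,1,\dots$: (i) $y^0=s^0=0$ and, for $t=1,\dots,N$, $y^t=s^{t-1}-\frac1{\widetilde L_y}\nabla_y g(x_k,s^{t-1})$, $s^t=\frac{2\sqrt{\kappa_y}}{\sqrt{\kappa_y}+1}y^t-\frac{\sqrt{\kappa_y}-1}{\sqrt{\kappa_y}+1}y^{t-1}$; (ii) $v^M$ is obtained by the heavy-ball recursion $v^{t+1}=v^t-\lambda\big(\nabla_y^2 g(x_k,y^N)v^t-\nabla_y F(x_k,y^N)\big)+\theta(v^t-v^{t-1})$, $v^0=v^1=0$, with $M$ Hessian-vector products charged; (iii) $G_k=\nabla_xF(x_k,y^N)-\nabla_x\nabla_yg(x_k,y^N)v^M$; (iv) $z_{k+1}=x_k-\frac1LG_k$, $x_{k+1}=\big(1+\frac{\sqrt{\kappa}-1}{\sqrt{\kappa}+1}\big)z_{k+1}-\frac{\sqrt{\kappa}-1}{\sqrt{\kappa}+1}z_k$.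 The complexity of computing $z_K$ is $\tau(n_J+n_H)+n_G$, where $n_J,n_H,n_G$ count the Jacobian-vector products, Hessian-vector products and (partial) gradient evaluations used in the first $K$ iterations, and $\tau>0$ is a fixed constant. **Parameters.** For $R>0$ let $\widetilde f(x,y)=f(x,y)+\frac{\epsilon}{2R}\|x\|^2$, $\widetilde\Phi(x)=\Phi(x)+\frac{\epsilon}{2R}\|x\|^2$, let $\widetilde x^*$ be the minimizer of $\widetilde\Phi$, let $\mu=\frac{\epsilon}{R}$, and for $\epsilon'>0$ let $$\begin{aligned}\Lambda_R(\epsilon')={}&L_x+\tfrac{\epsilon}{R}+\tfrac{2L_{xy}\widetilde L_{xy}}{\mu_y}+\tfrac{L_y\widetilde L_{xy}^2}{\mu_y^2}+\Big(\tfrac{\widetilde L_{xy}\rho_{yy}}{\mu_y^2}+\tfrac{\rho_{xy}}{\mu_y}\Big)\Big(1+\tfrac{\widetilde L_{xy}}{\mu_y}\Big)\Big[\|\nabla_yf(\widetilde x^*,y^*(\widetilde x^*))\|\\&+3\Big(L_{xy}+\tfrac{L_y\widetilde L_{xy}}{\mu_y}\Big)\sqrt{\tfrac{2}{\mu}\big(\widetilde\Phi(0)-\widetilde\Phi(\widetilde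 x^*)\big)+\|\widetilde x^*\|^2+\tfrac{\epsilon'}{\mu}}\,\Big].\end{aligned}$$ Put also $$\Delta^*=\|\nabla_yf(x^*,y^*(x^*))\|+\frac{\|x^*\|}{\mu_y}+\frac{(\|x^*\|+1)\sqrt{\Phi(0)-\Phi(x^*)}}{\sqrt\epsilon\,\mu_y},$$ $$\mathcal L=\log\Big(2+\tfrac1\epsilon+\tfrac1{\mu_y}+\Delta^*+\|y^*(x^*)\|+\widetilde L_y+\rho_{xy}+\rho_{yy}\Big).$$ **Theorem.** For all $\ell\in\mathbb R$ and $\tau>0$ there is a constant $C>0$, depending only on $\ell$ and $\tau$, such that the following holds for all $p,q,f,g,x^*$ as above with $L_x,L_{xy},L_y,\widetilde L_{xy},\mu_y\le\ell$ and all $\epsilon>0$. 1. (Suboptimality gap.) With $R=B^2$, there is $L=\Lambda_R(\epsilon/2)$ and there are $K,N,M\in\mathbb N$ such that AccBiO, applied to $\widetilde f$ and $g$ with parameters $L,\ \mu=\epsilon/R,\ N,M$, satisfies $\Phi(z_K)-\Phi(x^*)\le\epsilon$ with complexity at most $$C\,B\Big(\sqrt{\tfrac{\widetilde L_y}{\epsilon\mu_y^3}}+\Big(\sqrt{\tfrac{\rho_{yy}\widetilde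 L_y}{\epsilon\mu_y^4}}+\sqrt{\tfrac{\rho_{xy}\widetilde L_y}{\epsilon\mu_y^3}}\Big)\sqrt{\Delta^*}\Big)\,\mathcal L^2.$$ 2. (Gradient norm.) The function $\Phi$ is differentiable. With $R=B$, there is $L>0$ with $L=\Lambda_R\big(\epsilon^2/(4L+\tfrac{8\epsilon}{R})\big)$ and there are $K,N,M\in\mathbb N$ such that AccBiO, applied to $\widetilde f$ and $g$ with parameters $L,\ \mu=\epsilon/R,\ N,M$, satisfies $\|\nabla\Phi(z_K)\|\le5\epsilon$ with complexity at most $$C\Big(\sqrt{\tfrac{B\widetilde L_y}{\epsilon\mu_y^3}}+\Big(\sqrt{\tfrac{B\rho_{yy}\widetilde L_y}{\epsilon\mu_y^4}}+\sqrt{\tfrac{B\rho_{xy}\widetilde L_y}{\epsilon\mu_y^3}}\Big)\sqrt{\Delta^*}\Big)\,\mathcal L^2.$$ -/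

import Mathlib

open Set

noncomputable section

/-! # Oracle computations with an explicit count of the oracle calls -/

/-- Numbers of oracle calls: gradient evaluations, Jacobian-vector products and
Hessian-vector products. -/
structure OracleCost where
  nG : ℕ
  nJ : ℕ
  nH : ℕ

/-- The complexity measure `τ (n_J + n_H) + n_G`. -/
def OracleCost.total (τ : ℝ) (c : OracleCost) : ℝ :=
  τ * ((c.nJ : ℝ) + (c.nH : ℝ)) + (c.nG : ℝ)

/-- The result of a computation, together with the oracle calls that it has used. -/
structure Run (α : Type*) where
  val : α
  cost : OracleCost

/-- A computation that uses no oracle call. -/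
def Run.pure {α : Type*} (a : α) : Run α := ⟨a, ⟨0, 0, 0⟩⟩

/-- Sequential composition: the numbers of oracle calls add up. -/
def Run.bind {α β : Type*} (r : Run α) (k : α → Run β) : Run β :=
  ⟨(k r.val).val,
    ⟨r.cost.nG + (k r.val).cost.nG, r.cost.nJ + (k r.val).cost.nJ,
      r.cost.nH + (k r.val).cost.nH⟩⟩

section Bilevel

variable {E F : Type*}
  [NormedAddCommGroup E] [InnerProductSpace ℝ E] [CompleteSpace E]
  [NormedAddCommGroup F] [InnerProductSpace ℝ F] [CompleteSpace F]

/-! # Derivatives of the outer function `f` and of the inner function `g` -/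

/-- The partial gradient `∇_x f (x, y)`. -/
def gradX (f : E → F → ℝ) (x : E) (y : F) : E := gradient (fun x' => f x' y) x

/-- The partial gradient `∇_y f (x, y)`. -/
def gradY (f : E → F → ℝ) (x : E) (y : F) : F := gradient (fun y' => f x y') y

/-- The Hessian `∇_y² g (x, y)`, the derivative in `y` of `∇_y g`. -/
def hessYY (g : E → F → ℝ) (x : E) (y : F) : F →L[ℝ] F :=
  fderiv ℝ (fun y' => gradY g x y') y

/-- The Jacobian `∇_x ∇_y g (x, y)` (for `E = ℝ^p` and `F = ℝ^q` the `p × q` matrix with entries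
`∂² g / ∂x_i ∂y_j`): the transpose of the derivative in `x` of `∇_y g`. -/
def jacXY (g : E → F → ℝ) (x : E) (y : F) : F →L[ℝ] E :=
  ContinuousLinearMap.adjoint (fderiv ℝ (fun x' => gradY g x' y) x)

/-! # The bilevel problem -/

/-- A global minimizer of `h` (an arbitrary point if there is none). -/
def argminPt {α : Type*} [Nonempty α] (h : α → ℝ) : α :=
  Classical.epsilon (fun a => ∀ b, h a ≤ h b)

/-- `y*(x)`, the minimizer of the inner function `g(x, ·)`. -/
def yStar (g : E → F → ℝ) (x : E) : F := argminPt (g x)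

/-- The objective `Φ(x) = f(x, y*(x))`. -/
def bilevelObj (f g : E → F → ℝ) (x : E) : ℝ := f x (yStar g x)

/-- The convex-strongly-convex class: `f` has Lipschitz gradients with constants `Lx, Lxy, Ly`,
the gradient `∇_y g` is Lipschitz with constants `Lxy'` (in `x`) and `Ly'` (in `y`), the Jacobian
`∇_x ∇_y g` and the Hessian `∇_y² g` are Lipschitz with constants `ρxy` and `ρyy` in the Euclidean
norm of `(x, y)`, every `g(x, ·)` is `μy`-strongly convex, and `Φ` is convex. -/
structure IsConvexStronglyConvex (f g : E → F → ℝ)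
    (Lx Lxy Ly Lxy' Ly' ρxy ρyy μy : ℝ) : Prop where
  contDiff_f : ContDiff ℝ 1 (fun z : E × F => f z.1 z.2)
  contDiff_g : ContDiff ℝ 2 (fun z : E × F => g z.1 z.2)
  Lx_nonneg : 0 ≤ Lx
  Lxy_nonneg : 0 ≤ Lxy
  Ly_nonneg : 0 ≤ Ly
  Lxy'_nonneg : 0 ≤ Lxy'
  Ly'_nonneg : 0 ≤ Ly'
  ρxy_nonneg : 0 ≤ ρxy
  ρyy_nonneg : 0 ≤ ρyy
  μy_pos : 0 < μy
  gradX_f_lip_x : ∀ x₁ x₂ y, ‖gradX f x₁ y - gradX f x₂ y‖ ≤ Lx * ‖x₁ - x₂‖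
  gradX_f_lip_y : ∀ x y₁ y₂, ‖gradX f x y₁ - gradX f x y₂‖ ≤ Lxy * ‖y₁ - y₂‖
  gradY_f_lip_x : ∀ x₁ x₂ y, ‖gradY f x₁ y - gradY f x₂ y‖ ≤ Lxy * ‖x₁ - x₂‖
  gradY_f_lip_y : ∀ x y₁ y₂, ‖gradY f x y₁ - gradY f x y₂‖ ≤ Ly * ‖y₁ - y₂‖
  gradY_g_lip_x : ∀ x₁ x₂ y, ‖gradY g x₁ y - gradY g x₂ y‖ ≤ Lxy' * ‖x₁ - x₂‖
  gradY_g_lip_y : ∀ x y₁ y₂, ‖gradY g x y₁ - gradY g x y₂‖ ≤ Ly' * ‖y₁ - y₂‖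
  jacXY_g_lip : ∀ x₁ x₂ y₁ y₂, ‖jacXY g x₁ y₁ - jacXY g x₂ y₂‖ ≤
    ρxy * √(‖x₁ - x₂‖ ^ 2 + ‖y₁ - y₂‖ ^ 2)
  hessYY_g_lip : ∀ x₁ x₂ y₁ y₂, ‖hessYY g x₁ y₁ - hessYY g x₂ y₂‖ ≤
    ρyy * √(‖x₁ - x₂‖ ^ 2 + ‖y₁ - y₂‖ ^ 2)
  strongConvex_g : ∀ x, StrongConvexOn univ μy (g x)
  convex_obj : ConvexOn ℝ univ (bilevelObj f g)

/-- The regularized outer function `f(x, y) + (c / 2) ‖x‖²`. -/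
def regularize (f : E → F → ℝ) (c : ℝ) (x : E) (y : F) : ℝ := f x y + c / 2 * ‖x‖ ^ 2

/-! # The algorithm AccBiO -/

/-- Oracle call: the gradient `∇_x f (x, y)`. -/
def callGradX (f : E → F → ℝ) (x : E) (y : F) : Run E := ⟨gradX f x y, ⟨1, 0, 0⟩⟩

/-- Oracle call: the gradient `∇_y f (x, y)`. -/
def callGradY (f : E → F → ℝ) (x : E) (y : F) : Run F := ⟨gradY f x y, ⟨1, 0, 0⟩⟩

/-- Oracle call: the Jacobian-vector product `∇_x ∇_y g (x, y) v`. -/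
def callJac (g : E → F → ℝ) (x : E) (y v : F) : Run E := ⟨jacXY g x y v, ⟨0, 1, 0⟩⟩

/-- Oracle call: the Hessian-vector product `∇_y² g (x, y) v`. -/
def callHess (g : E → F → ℝ) (x : E) (y v : F) : Run F := ⟨hessYY g x y v, ⟨0, 0, 1⟩⟩

/-- Inner accelerated gradient descent on `g(x, ·)` started at `y⁰ = s⁰ = 0`, with condition number
`κy = Ly' / μy`; after `t` steps the state is `(y^t, s^t)`. -/
def innerAGD (g : E → F → ℝ) (Ly' μy : ℝ) (x : E) : ℕ → Run (F × F)
  | 0 => Run.pure (0, 0)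
  | t + 1 => (innerAGD g Ly' μy x t).bind fun st =>
      (callGradY g x st.2).bind fun d =>
        let y : F := st.2 - (1 / Ly') • d
        Run.pure (y, (2 * √(Ly' / μy) / (√(Ly' / μy) + 1)) • y
          - ((√(Ly' / μy) - 1) / (√(Ly' / μy) + 1)) • st.1)

/-- Heavy-ball method `v^{t+1} = v^t - lam ∇Q(v^t) + θ (v^t - v^{t-1})` with `v⁰ = v¹ = 0` on
`Q(v) = ½ ⟨v, ∇_y² g(x, y) v⟩ - ⟨v, b⟩`; after `t` steps the state is `(v^t, v^{t+1})`. -/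
def heavyBall (g : E → F → ℝ) (lam θ : ℝ) (x : E) (y b : F) : ℕ → Run (F × F)
  | 0 => Run.pure (0, 0)
  | t + 1 => (heavyBall g lam θ x y b t).bind fun st =>
      (callHess g x y st.2).bind fun hv =>
        Run.pure (st.2, st.2 - lam • (hv - b) + θ • (st.2 - st.1))

/-- The heavy-ball step size `4 / (√Ly' + √μy)²`. -/
def hbStep (Ly' μy : ℝ) : ℝ := 4 / (√Ly' + √μy) ^ 2

/-- The heavy-ball momentum `max {(1 - √(lam μy))², (1 - √(lam Ly'))²}`. -/
def hbMomentum (Ly' μy : ℝ) : ℝ :=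
  max ((1 - √(hbStep Ly' μy * μy)) ^ 2) ((1 - √(hbStep Ly' μy * Ly')) ^ 2)

/-- The hypergradient estimate `G = ∇_x f(x, y^N) - ∇_x ∇_y g(x, y^N) v^M`. -/
def hypergrad (f g : E → F → ℝ) (Ly' μy : ℝ) (N M : ℕ) (x : E) : Run E :=
  (innerAGD g Ly' μy x N).bind fun ys =>
  (callGradY f x ys.1).bind fun b =>
  (heavyBall g (hbStep Ly' μy) (hbMomentum Ly' μy) x ys.1 b M).bind fun vs =>
  (callJac g x ys.1 vs.1).bind fun w =>
  (callGradX f x ys.1).bind fun a =>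
  Run.pure (a - w)

/-- AccBiO for the outer function `f` and the inner function `g`, with step size `1 / LΦ`, condition
number `κx = LΦ / μx` and `z₀ = x₀ = 0`; after `K` outer iterations the state is `(z_K, x_K)`. -/
def accBiO (f g : E → F → ℝ) (Ly' μy LΦ μx : ℝ) (N M : ℕ) : ℕ → Run (E × E)
  | 0 => Run.pure (0, 0)
  | k + 1 => (accBiO f g Ly' μy LΦ μx N M k).bind fun st =>
      (hypergrad f g Ly' μy N M st.2).bind fun G =>
        let z : E := st.2 - (1 / LΦ) • G
        Run.pure (z, (1 + (√(LΦ / μx) - 1) / (√(LΦ / μx) + 1)) • z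
          - ((√(LΦ / μx) - 1) / (√(LΦ / μx) + 1)) • st.1)

/-! # The quantities in the bounds -/

/-- The smoothness parameter `L_Φ` that AccBiO uses for a `μx`-strongly convex objective `Φ` and
target accuracy `ε`; here `x*` is the minimizer of `Φ`. -/
def smoothParam (f g : E → F → ℝ) (Lx Lxy Ly Lxy' ρxy ρyy μy μx ε : ℝ) : ℝ :=
  let xs : E := argminPt (bilevelObj f g)
  Lx + 2 * Lxy * Lxy' / μy + Ly * Lxy' ^ 2 / μy ^ 2
    + (Lxy' * ρyy / μy ^ 2 + ρxy / μy) * (1 + Lxy' / μy) * ‖gradY f xs (yStar g xs)‖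
    + 3 * (Lxy' * ρyy / μy ^ 2 + ρxy / μy) * (1 + Lxy' / μy) * (Lxy + Ly * Lxy' / μy)
      * √(2 / μx * (bilevelObj f g 0 - bilevelObj f g xs) + ‖xs‖ ^ 2 + ε / μx)

/-- `Δ*_CSC` for the minimizer `xs` of `Φ`. -/
def deltaCSC (f g : E → F → ℝ) (xs : E) (μy ε : ℝ) : ℝ :=
  ‖gradY f xs (yStar g xs)‖ + ‖xs‖ / μy
    + (‖xs‖ + 1) * √(bilevelObj f g 0 - bilevelObj f g xs) / (√ε * μy)

/-- The sum of problem parameters whose logarithm enters the bounds. -/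
def logArg (f g : E → F → ℝ) (xs : E) (Ly' ρxy ρyy μy ε : ℝ) : ℝ :=
  2 + 1 / ε + 1 / μy + deltaCSC f g xs μy ε + ‖yStar g xs‖ + Ly' + ρxy + ρyy

end Bilevel

end

set_option linter.unusedSectionVars false

/-! ### Gradient inequalities and accelerated descent with inexact gradients. -/

section Convex

local notation "⟪" x ", " y "⟫" => inner ℝ x y

variable {E : Type*} [NormedAddCommGroup E] [InnerProductSpace ℝ E]

/-! Since `∇_y f` is unbounded, `∇Φ` need not be globally Lipschitz. What survives is a one-centre
estimate: the difference of the hypergradients at `x` and at `c` is at most a constant times `‖x -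
c‖` for every `x`, with a constant affine in `‖∇_y f(c, y*(c))‖` (`exactHypergrad_sub_le`,
`gradient_lipschitz_at`), and that norm grows at most linearly with the distance of `c` from a
reference point (`norm_gradY_yStar_le`). The descent inequality at `c` needs nothing more.

Accelerated descent on an `m`-strongly convex function therefore works once its query points are
known to stay near the minimizer. The usual energy argument supplies this by itself: as long as the
gradient errors are small, the `z_k` stay in a ball of radius `D` and the extrapolated points `x_k`
in the ball of radius `3D` (`accelerated_step`, `radius_le_of_energy_le`, `accelerated_inexact`).
The parameter `smoothParam` is the one-centre constant valid on the larger ball.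

The gradient error comes from the two inner loops. Accelerated descent on `g(x, ·)` is the same
convergence theorem with error zero. The heavy-ball loop is diagonalized in an eigenbasis of the
Hessian, where each coordinate obeys a two-term recurrence with characteristic roots of equal
modulus (`heavy_ball_bound`). Both errors decay like `exp(-t / (2√κ_y))`, up to polynomial factors,
so a number of inner steps of order `√κ_y` times a logarithm suffices.

A convex `Φ` is made strongly convex by adding `ε/(2R) ‖x‖²`. If the origin already meets the
target, zero iterations are taken. Otherwise `ε/R` is at most the smoothness of `Φ` at `x*`, so that
`L` is bounded by `1/μ_y² + (ρ_yy/μ_y³ + ρ_xy/μ_y²) Δ*` up to a power of `ℓ`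
(`smoothParam_regularize_le`). The product `√κ √κ_y` then splits into the three square roots of the
claimed bound (`sqrt_cond_mul_le`). All other constants are at most a fixed power of `ℓ` times the
argument of the logarithm, so each loop contributes one logarithmic factor
(`regularized_complexity`). -/

theorem StrongConvexOn.add_mul_sq_norm {h : E → ℝ} {m : ℝ} (hc : ConvexOn ℝ univ h) :
    StrongConvexOn univ m (fun x => h x + m / 2 * ‖x‖ ^ 2) := by
  rw [strongConvexOn_iff_convex]
  simpa using hc

/-- One step of accelerated gradient descent with the inexact gradient `L • s`. -/
theorem accelerated_step {h : E → ℝ} {L a : ℝ} {x z s xs g W : E} (hL : 0 ≤ L) (ha0 : 0 ≤ a)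
    (ha1 : a ≤ 1) (hW : W = (1 + a) • x - z - a • xs)
    (h1 : h (x - s) ≤ h x + ⟪g, (x - s) - x⟫ + L / 2 * ‖(x - s) - x‖ ^ 2)
    (h2 : h x + ⟪g, z - x⟫ ≤ h z)
    (h3 : h x + ⟪g, xs - x⟫ + a ^ 2 * L / 2 * ‖xs - x‖ ^ 2 ≤ h xs) :
    h (x - s) - h xs + L / 2 * ‖(x - s) - (1 - a) • z - a • xs‖ ^ 2 ≤
      (1 - a) * (h z - h xs + L / 2 * ‖W‖ ^ 2)
        + ⟪L • s - g, (1 - a) • (z - xs) - ((x - s) - xs)⟫ := by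
  -- Coordinates centred at `xs`, in which `z - x = a • r - W`. The sum of `h1`, `(1 - a)` times
  -- `h2` and `a` times `h3` gives the claim with the slack `L/2 * a(1 - a) ‖x - z‖²`, which is
  -- `hsq`.
  obtain ⟨r, rfl⟩ : ∃ r, x = xs + r := ⟨x - xs, by abel⟩
  obtain rfl : z = xs + r + (a • r - W) := by rw [hW]; module
  have e1 : xs + r - s - (xs + r) = -s := by abel
  have e2 : xs + r + (a • r - W) - (xs + r) = a • r - W := by abel
  have e3 : xs - (xs + r) = -r := by abel
  have e4 : xs + r - s - (1 - a) • (xs + r + (a • r - W)) - a • xs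
      = (a ^ 2) • r + (1 - a) • W - s := by module
  have e5 : (1 - a) • (xs + r + (a • r - W) - xs) - (xs + r - s - xs)
      = (1 - a) • (a • r - W) - a • r + s := by module
  rw [e1, norm_neg, inner_neg_right] at h1
  rw [e2] at h2
  rw [e3, norm_neg, inner_neg_right] at h3
  rw [e4, e5]
  have hsq : 0 ≤ L / 2 * (a * (1 - a)) * ‖W - a • r‖ ^ 2 := by
    have : 0 ≤ 1 - a := by linarith
    positivity
  have h2' := mul_le_mul_of_nonneg_left h2 (show 0 ≤ 1 - a by linarith)
  have h3' := mul_le_mul_of_nonneg_left h3 ha0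
  simp only [← real_inner_self_eq_norm_sq, inner_add_left, inner_add_right, inner_sub_left,
    inner_sub_right, real_inner_smul_left, real_inner_smul_right] at *
  rw [real_inner_comm r W, real_inner_comm r s, real_inner_comm W s] at *
  linarith

variable [CompleteSpace E]

theorem HasGradientAt.hasDerivAt_line {h : E → ℝ} {v x d : E} {t : ℝ}
    (hh : HasGradientAt h v (x + t • d)) :
    HasDerivAt (fun s : ℝ => h (x + s • d)) ⟪v, d⟫ t := by
  have h1 : HasDerivAt (fun s : ℝ => x + s • d) d t := by
    simpa using ((hasDerivAt_id t).smul_const d).const_add x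
  have h2 := (hasGradientAt_iff_hasFDerivAt.1 hh).comp_hasDerivAt t h1
  simpa [Function.comp_def] using h2

theorem StrongConvexOn.add_inner_gradient_le {h : E → ℝ} {m : ℝ} {v x : E}
    (hs : StrongConvexOn univ m h) (hv : HasGradientAt h v x) (y : E) :
    h x + ⟪v, y - x⟫ + m / 2 * ‖y - x‖ ^ 2 ≤ h y := by
  have hd : HasDerivAt (fun s : ℝ => h (x + s • (y - x))) ⟪v, y - x⟫ 0 :=
    HasGradientAt.hasDerivAt_line (by simpa using hv)
  have ht := (hasDerivAt_iff_tendsto_slope_zero.1 hd).mono_left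
    (nhdsWithin_mono (0 : ℝ) (fun t (ht : 0 < t) => ne_of_gt ht) :
      nhdsWithin (0 : ℝ) (Ioi 0) ≤ _)
  have hr : Filter.Tendsto (fun t : ℝ => h y - h x - (1 - t) * (m / 2 * ‖y - x‖ ^ 2))
      (nhdsWithin 0 (Ioi 0)) (nhds (h y - h x - (1 - 0) * (m / 2 * ‖y - x‖ ^ 2))) := by
    apply Filter.Tendsto.mono_left _ nhdsWithin_le_nhds
    exact Continuous.tendsto (by fun_prop) 0
  have hle := le_of_tendsto_of_tendsto ht hr (by
    filter_upwards [Ioo_mem_nhdsGT (show (0 : ℝ) < 1 by norm_num)] with t ht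
    have hc := hs.2 (mem_univ x) (mem_univ y) (show 0 ≤ 1 - t by linarith [ht.2]) ht.1.le
      (by ring)
    have e : (1 - t) • x + t • y = x + t • (y - x) := by module
    rw [e, norm_sub_rev] at hc
    simp only [zero_add, zero_smul, add_zero, smul_eq_mul] at hc ⊢
    rw [inv_mul_le_iff₀ ht.1]
    nlinarith)
  linarith

/-- Along the segment from `x`, the difference between `h` and its quadratic model is nonincreasing.
Only gradient differences from the base point occur, so no global Lipschitz constant is needed. -/
theorem le_add_inner_add_of_gradient_lipschitz_at {h : E → ℝ} {h' : E → E} {L : ℝ} {x : E}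
    (hh : ∀ y, HasGradientAt h (h' y) y) (hL : ∀ y, ‖h' y - h' x‖ ≤ L * ‖y - x‖) (y : E) :
    h y ≤ h x + ⟪h' x, y - x⟫ + L / 2 * ‖y - x‖ ^ 2 := by
  set d := y - x with hd
  let φ : ℝ → ℝ := fun t => h (x + t • d) - t * ⟪h' x, d⟫ - t ^ 2 * (L / 2 * ‖d‖ ^ 2)
  have hφ : ∀ t, HasDerivAt φ (⟪h' (x + t • d), d⟫ - ⟪h' x, d⟫ - 2 * t * (L / 2 * ‖d‖ ^ 2)) t := by
    intro t
    have h1 := HasGradientAt.hasDerivAt_line (hh (x + t • d))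
    have h2 := (hasDerivAt_id t).mul_const ⟪h' x, d⟫
    have h3 := (hasDerivAt_pow 2 t).mul_const (L / 2 * ‖d‖ ^ 2)
    exact ((h1.sub h2).sub h3).congr_deriv (by simp)
  have hanti : AntitoneOn φ (Icc 0 1) := by
    apply antitoneOn_of_deriv_nonpos (convex_Icc 0 1)
    · exact fun t _ => (hφ t).continuousAt.continuousWithinAt
    · exact fun t _ => (hφ t).differentiableAt.differentiableWithinAt
    · intro t ht
      rw [interior_Icc] at ht
      rw [(hφ t).deriv, ← inner_sub_left]
      have h1 := real_inner_le_norm (h' (x + t • d) - h' x) d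
      have h2 := hL (x + t • d)
      rw [add_sub_cancel_left, norm_smul, Real.norm_of_nonneg ht.1.le] at h2
      have h3 := mul_le_mul_of_nonneg_right h2 (norm_nonneg d)
      nlinarith
  have := hanti (left_mem_Icc.2 zero_le_one) (right_mem_Icc.2 zero_le_one) zero_le_one
  simp only [φ, hd, one_smul, zero_smul, add_zero, add_sub_cancel] at this
  simp only [hd]
  nlinarith

theorem HasGradientAt.eq_zero_of_forall_le {h : E → ℝ} {v x : E} (hv : HasGradientAt h v x)
    (hx : ∀ y, h x ≤ h y) : v = 0 := by
  have h1 : IsLocalMin h x := Filter.Eventually.of_forall hx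
  have h2 := h1.hasFDerivAt_eq_zero (hasGradientAt_iff_hasFDerivAt.1 hv)
  simpa using h2

theorem StrongConvexOn.sq_dist_le_of_forall_le {h : E → ℝ} {m : ℝ} {v x : E}
    (hs : StrongConvexOn univ m h) (hv : HasGradientAt h v x) (hx : ∀ y, h x ≤ h y) (y : E) :
    m / 2 * ‖y - x‖ ^ 2 ≤ h y - h x := by
  have h1 := hs.add_inner_gradient_le hv y
  rw [hv.eq_zero_of_forall_le hx, inner_zero_left] at h1
  linarith

theorem StrongConvexOn.mul_sq_norm_sub_le_inner {h : E → ℝ} {m : ℝ} {v w x y : E}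
    (hs : StrongConvexOn univ m h) (hv : HasGradientAt h v x) (hw : HasGradientAt h w y) :
    m * ‖y - x‖ ^ 2 ≤ ⟪w - v, y - x⟫ := by
  have h1 := hs.add_inner_gradient_le hv y
  have h2 := hs.add_inner_gradient_le hw x
  rw [← neg_sub y x, inner_neg_right, norm_neg] at h2
  rw [inner_sub_left]
  linarith

theorem StrongConvexOn.mul_norm_sub_le {h : E → ℝ} {m : ℝ} {v w x y : E}
    (hs : StrongConvexOn univ m h) (hv : HasGradientAt h v x) (hw : HasGradientAt h w y) :
    m * ‖y - x‖ ≤ ‖w - v‖ := by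
  rcases eq_or_lt_of_le (norm_nonneg (y - x)) with h0 | h0
  · rw [← h0]; simp
  · have h1 := (hs.mul_sq_norm_sub_le_inner hv hw).trans (real_inner_le_norm _ _)
    refine le_of_mul_le_mul_right ?_ h0
    nlinarith

theorem StrongConvexOn.exists_forall_le [FiniteDimensional ℝ E] {h : E → ℝ} {m : ℝ}
    (hs : StrongConvexOn univ m h) (hm : 0 < m) (hd : Differentiable ℝ h) :
    ∃ x, ∀ y, h x ≤ h y := by
  apply hd.continuous.exists_forall_le
  have hlow : ∀ y, h 0 - ‖gradient h 0‖ * ‖y‖ + m / 2 * ‖y‖ ^ 2 ≤ h y := by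
    intro y
    have h1 := hs.add_inner_gradient_le (hd 0).hasGradientAt y
    have h2 := neg_le_of_abs_le (abs_real_inner_le_norm (gradient h 0) y)
    rw [sub_zero] at h1
    linarith
  refine Filter.tendsto_atTop_mono hlow ?_
  have h1 : Filter.Tendsto (fun t : ℝ => h 0 + t * (m / 2 * t - ‖gradient h 0‖)) Filter.atTop
      Filter.atTop := by
    apply Filter.tendsto_atTop_add_const_left
    apply Filter.Tendsto.atTop_mul_atTop₀ Filter.tendsto_id
    apply Filter.tendsto_atTop_add_const_right
    exact Filter.tendsto_id.const_mul_atTop (by positivity)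
  refine (h1.comp (tendsto_norm_cocompact_atTop (E := E))).congr fun y => ?_
  simp only [Function.comp]
  ring

/-- The minimum value is compared with the value after one gradient step of length `1/L` from `x`;
again only the bound centred at `x` enters. -/
theorem sq_norm_gradient_le {h : E → ℝ} {h' : E → E} {L : ℝ} {x xs : E} (hL0 : 0 < L)
    (hh : ∀ y, HasGradientAt h (h' y) y) (hL : ∀ y, ‖h' y - h' x‖ ≤ L * ‖y - x‖)
    (hxs : ∀ y, h xs ≤ h y) : ‖h' x‖ ^ 2 ≤ 2 * L * (h x - h xs) := by
  have h1 := le_add_inner_add_of_gradient_lipschitz_at hh hL (x - (1 / L) • h' x)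
  have h2 := hxs (x - (1 / L) • h' x)
  rw [sub_sub_cancel_left, inner_neg_right, norm_neg, real_inner_smul_right, norm_smul,
    real_inner_self_eq_norm_sq, Real.norm_of_nonneg (by positivity)] at h1
  have h3 : L / 2 * (1 / L * ‖h' x‖) ^ 2 = ‖h' x‖ ^ 2 / (2 * L) := by field_simp
  have h4 : 1 / L * ‖h' x‖ ^ 2 = 2 * (‖h' x‖ ^ 2 / (2 * L)) := by field_simp
  have h5 : ‖h' x‖ ^ 2 / (2 * L) ≤ h x - h xs := by linarith
  rw [div_le_iff₀ (by positivity)] at h5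
  linarith

/-- The error term contains the very distance `r` that is to be bounded. If `r > D`, then `U ≤ (m/2)
r²` and `D (D + r) < 2 r²`, and the hypotheses would give `V < (m/2) r²`. -/
theorem radius_le_of_energy_le {a m D δ r U V : ℝ} (ha0 : 0 < a) (ha1 : a ≤ 1) (hm : 0 < m)
    (hD : 0 ≤ D) (hδ : 4 * δ ≤ a * m * D) (hU : U ≤ m / 2 * D ^ 2)
    (hV : V ≤ (1 - a) * U + δ * (D + r)) (hr : m / 2 * r ^ 2 ≤ V) : r ≤ D := by
  by_contra! hlt
  have h1 : (1 - a) * U ≤ (1 - a) * (m / 2 * r ^ 2) := by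
    apply mul_le_mul_of_nonneg_left _ (by linarith)
    refine hU.trans (mul_le_mul_of_nonneg_left ?_ (by positivity))
    gcongr
  have h2 : δ * (D + r) ≤ a * m * D / 4 * (D + r) :=
    mul_le_mul_of_nonneg_right (by linarith) (by linarith)
  have h3 : D * (D + r) < 2 * r ^ 2 := by nlinarith
  have h4 := mul_lt_mul_of_pos_left h3 (show 0 < a * m / 4 by positivity)
  linarith

/-- Accelerated gradient descent for an `m`-strongly convex function with minimizer `xs`. The
descent inequality and the accuracy `δ` of the gradients are needed only near `xs`. -/
theorem accelerated_inexact {h : E → ℝ} {h' G : E → E} {L m D δ : ℝ} {xs : E} {z x : ℕ → E}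
    (hh : ∀ y, HasGradientAt h (h' y) y) (hs : StrongConvexOn univ m h)
    (hxs : ∀ y, h xs ≤ h y) (hm : 0 < m) (hmL : m ≤ L) (hδ : 0 ≤ δ) (hD : 0 ≤ D)
    (hz0 : z 0 = 0) (hx0 : x 0 = 0)
    (hz : ∀ k, z (k + 1) = x k - (1 / L) • G (x k))
    (hx : ∀ k, x (k + 1) = (1 + (√(L / m) - 1) / (√(L / m) + 1)) • z (k + 1)
      - ((√(L / m) - 1) / (√(L / m) + 1)) • z k)
    (hdesc : ∀ u, ‖u - xs‖ ≤ 3 * D → ∀ y, h y ≤ h u + ⟪h' u, y - u⟫ + L / 2 * ‖y - u‖ ^ 2)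
    (hG : ∀ u, ‖u - xs‖ ≤ 3 * D → ‖G u - h' u‖ ≤ δ)
    (hδD : 4 * δ * √(L / m) ≤ m * D)
    (hVD : h 0 - h xs + m / 2 * ‖xs‖ ^ 2 + 2 * δ * D * √(L / m) ≤ m / 2 * D ^ 2) (k : ℕ) :
    ‖z k - xs‖ ≤ D ∧
      h (z k) - h xs ≤ (1 - 1 / √(L / m)) ^ k * (h 0 - h xs + m / 2 * ‖xs‖ ^ 2)
        + 2 * δ * D * √(L / m) := by
  have hL : 0 < L := hm.trans_le hmL
  set κ := √(L / m) with hκ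
  have hκ1 : 1 ≤ κ := by
    rw [hκ, Real.one_le_sqrt, one_le_div hm]; exact hmL
  have hκ0 : 0 < κ := by linarith
  have hκsq : m * κ ^ 2 = L := by
    rw [hκ, Real.sq_sqrt (by positivity)]; field_simp
  set a := 1 / κ with ha
  have haκ : a * κ = 1 := by rw [ha]; field_simp
  have ha0 : 0 < a := by positivity
  have ha1 : a ≤ 1 := by rw [ha, div_le_one hκ0]; exact hκ1
  have ham : a ^ 2 * L = m := by
    rw [← hκsq]
    linear_combination m * (a * κ + 1) * haκ
  set β := (κ - 1) / (κ + 1) with hβ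
  have hβ0 : 0 ≤ β := div_nonneg (by linarith) (by linarith)
  have hβ1 : β ≤ 1 := by rw [hβ, div_le_one (by linarith)]; linarith
  have hβa : (1 + a) * β = 1 - a := by
    rw [hβ, ha]; field_simp
  set V0 := h 0 - h xs + m / 2 * ‖xs‖ ^ 2 with hV0
  have hV0n : 0 ≤ V0 := by
    have h1 := hxs 0
    have h2 : 0 ≤ m / 2 * ‖xs‖ ^ 2 := by positivity
    linarith
  have hdist : ∀ y, m / 2 * ‖y - xs‖ ^ 2 ≤ h y - h xs := hs.sq_dist_le_of_forall_le (hh xs) hxs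
  -- The two distance bounds and the energy bound feed each other and are proved together. Each step
  -- adds an error of at most `2 δ D`; its geometric sum with ratio `1 - 1/κ` is `2 δ D κ`.
  suffices H : ∀ k, ‖z k - xs‖ ≤ D ∧ ‖x k - xs‖ ≤ 3 * D ∧
      h (z k) - h xs + L / 2 * ‖(1 + a) • x k - z k - a • xs‖ ^ 2 ≤
        (1 - a) ^ k * V0 + 2 * δ * D * κ by
    obtain ⟨h1, -, h3⟩ := H k
    refine ⟨h1, le_trans ?_ h3⟩
    have : 0 ≤ L / 2 * ‖(1 + a) • x k - z k - a • xs‖ ^ 2 := by positivity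
    linarith
  intro k
  induction k with
  | zero =>
    have h1 := hdist 0
    have hδDκ : 0 ≤ 2 * δ * D * κ := by positivity
    have h2 : ‖xs‖ ≤ D := by
      refine le_of_sq_le_sq ?_ hD
      rw [zero_sub, norm_neg] at h1
      have h5 : 0 ≤ m / 2 * ‖xs‖ ^ 2 := by positivity
      refine le_of_mul_le_mul_left (a := m / 2) ?_ (by positivity)
      linarith
    refine ⟨by simpa [hz0] using h2, ?_, ?_⟩
    · simp only [hx0, zero_sub, norm_neg]; linarith
    · simp only [hz0, hx0, smul_zero, zero_sub, sub_zero, norm_neg, norm_smul,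
        Real.norm_of_nonneg ha0.le, pow_zero, one_mul, hV0]
      have : L / 2 * (a * ‖xs‖) ^ 2 = m / 2 * ‖xs‖ ^ 2 := by rw [← ham]; ring
      linarith
  | succ k ih =>
    obtain ⟨ihz, ihx, ihV⟩ := ih
    have hzs : z (k + 1) = x k - (1 / L) • G (x k) := hz k
    have hstep := accelerated_step (h := h) (z := z k) (xs := xs) (s := (1 / L) • G (x k)) (g := h' (x k)) hL.le ha0.le
      ha1 rfl (hdesc _ ihx _)
      (by
        have := hs.add_inner_gradient_le (hh (x k)) (z k)
        have : 0 ≤ m / 2 * ‖z k - x k‖ ^ 2 := by positivity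
        linarith)
      (by rw [ham]; exact hs.add_inner_gradient_le (hh (x k)) xs)
    rw [← hzs, smul_smul, mul_one_div_cancel hL.ne', one_smul] at hstep
    -- The identity `(1 + a) β = 1 - a` is what fixes the momentum: the vector produced by
    -- `accelerated_step` becomes the `W` of the next step.
    have hW : (1 + a) • x (k + 1) - z (k + 1) - a • xs
        = z (k + 1) - (1 - a) • z k - a • xs := by
      rw [hx k, smul_sub, smul_smul, smul_smul, mul_add, hβa]; module
    rw [hW]
    have herr : inner ℝ (G (x k) - h' (x k)) ((1 - a) • (z k - xs) - (z (k + 1) - xs))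
        ≤ δ * (D + ‖z (k + 1) - xs‖) := by
      refine (real_inner_le_norm _ _).trans ?_
      refine mul_le_mul (hG _ ihx) ?_ (norm_nonneg _) hδ
      refine (norm_sub_le _ _).trans ?_
      rw [norm_smul, Real.norm_of_nonneg (by linarith)]
      nlinarith [norm_nonneg (z k - xs)]
    set V := h (z (k + 1)) - h xs + L / 2 * ‖z (k + 1) - (1 - a) • z k - a • xs‖ ^ 2 with hV
    have hVr : m / 2 * ‖z (k + 1) - xs‖ ^ 2 ≤ V := by
      have : 0 ≤ L / 2 * ‖z (k + 1) - (1 - a) • z k - a • xs‖ ^ 2 := by positivity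
      linarith [hdist (z (k + 1))]
    have hVk : V ≤ (1 - a) * ((1 - a) ^ k * V0 + 2 * δ * D * κ) + δ * (D + ‖z (k + 1) - xs‖) := by
      refine hstep.trans (add_le_add ?_ herr)
      exact mul_le_mul_of_nonneg_left ihV (by linarith)
    have hzD : ‖z (k + 1) - xs‖ ≤ D := by
      have h1 : (1 - a) ^ k * V0 ≤ V0 :=
        mul_le_of_le_one_left hV0n (pow_le_one₀ (by linarith) (by linarith))
      have h4 : 4 * δ ≤ a * m * D :=
        calc 4 * δ = a * (4 * δ * κ) := by linear_combination (-4 * δ) * haκ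
          _ ≤ a * (m * D) := mul_le_mul_of_nonneg_left hδD ha0.le
          _ = a * m * D := by ring
      exact radius_le_of_energy_le ha0 ha1 hm hD h4 (by linarith) hVk hVr
    refine ⟨hzD, ?_, ?_⟩
    -- The coefficients are at most `2` and `1`, whence the radius `3 * D`.
    · have : x (k + 1) - xs = (1 + β) • (z (k + 1) - xs) - β • (z k - xs) := by
        rw [hx k]; module
      rw [this]
      refine (norm_sub_le _ _).trans ?_
      rw [norm_smul, norm_smul, Real.norm_of_nonneg hβ0, Real.norm_of_nonneg (by linarith)]
      nlinarith [norm_nonneg (z k - xs), norm_nonneg (z (k + 1) - xs)]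
    · refine hVk.trans ?_
      have h1 : δ * (D + ‖z (k + 1) - xs‖) ≤ δ * (D + D) :=
        mul_le_mul_of_nonneg_left (by linarith) hδ
      have h2 : (1 - a) * (2 * δ * D * κ) + δ * (D + D) = 2 * δ * D * κ := by
        linear_combination (-2 * δ * D) * haκ
      rw [pow_succ]
      linarith

end Convex

/-! ### The heavy-ball method on a quadratic. -/

/-- Since `|s| ≤ 2q`, the characteristic roots are conjugate of modulus `q`. Factoring out one root,
`e (t + 1) - r' * e t` is geometric with ratio `r`; this first-order recursion yields the factor
linear in `t` and covers the double root without a case distinction. -/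
theorem abs_le_of_two_term_recurrence {s q a : ℝ} {e : ℕ → ℝ} (hq0 : 0 ≤ q) (hq1 : q ≤ 1)
    (hs : |s| ≤ 2 * q) (he0 : e 0 = a) (he1 : e 1 = a)
    (he : ∀ t, e (t + 2) = s * e (t + 1) - q ^ 2 * e t) (t : ℕ) :
    |e (t + 1)| ≤ 2 * (t + 2) * q ^ t * |a| := by
  have hdisc : 0 ≤ q ^ 2 - s ^ 2 / 4 := by
    have := sq_le_sq' (by linarith [(abs_le.1 hs).1]) (abs_le.1 hs).2
    linarith
  -- `r` and its conjugate are the roots of `X ^ 2 - s * X + q ^ 2`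
  let r : ℂ := ⟨s / 2, √(q ^ 2 - s ^ 2 / 4)⟩
  have hr2 : Complex.normSq r = q ^ 2 := by
    simp only [r, Complex.normSq_mk, Real.mul_self_sqrt hdisc]; ring
  have hrn : ‖r‖ = q := by
    rw [← Real.sqrt_sq hq0, ← hr2, Complex.normSq_eq_norm_sq, Real.sqrt_sq (norm_nonneg _)]
  set r' : ℂ := (starRingEnd ℂ) r with hr'
  have hrn' : ‖r'‖ = q := by rw [hr', Complex.norm_conj, hrn]
  have hprod : r * r' = (q : ℂ) ^ 2 := by
    rw [hr', Complex.mul_conj, hr2]; push_cast; rfl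
  have hsum : r + r' = (s : ℂ) := by
    rw [hr', Complex.add_conj]; simp only [r]; push_cast; ring
  have hgeo : ∀ t, (e (t + 1) : ℂ) - r' * e t = r ^ t * ((a : ℂ) - r' * a) := by
    intro t
    induction t with
    | zero => simp [he0, he1]
    | succ t ih =>
      rw [pow_succ', mul_assoc, ← ih, he t]
      push_cast
      rw [← hsum, ← hprod]; ring
  have hstep : ∀ t, |e (t + 1)| ≤ q * |e t| + 2 * q ^ t * |a| := by
    intro t
    have h1 : (e (t + 1) : ℂ) = r' * e t + r ^ t * ((a : ℂ) - r' * a) := by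
      rw [← hgeo t]; ring
    have h2 : ‖(e (t + 1) : ℂ)‖ ≤ ‖r'‖ * ‖(e t : ℂ)‖ + ‖r‖ ^ t * (‖(a : ℂ)‖ + ‖r'‖ * ‖(a : ℂ)‖) := by
      rw [h1]
      refine (norm_add_le _ _).trans ?_
      rw [norm_mul, norm_mul, norm_pow]
      gcongr
      refine (norm_sub_le _ _).trans ?_
      rw [norm_mul]
    rw [hrn, hrn', Complex.norm_real, Complex.norm_real, Complex.norm_real] at h2
    simp only [Real.norm_eq_abs] at h2
    have h3 : q ^ t * (q * |a|) ≤ q ^ t * |a| :=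
      mul_le_mul_of_nonneg_left (mul_le_of_le_one_left (abs_nonneg a) hq1) (by positivity)
    linarith
  induction t with
  | zero =>
    simp only [zero_add, he1, pow_zero, Nat.cast_zero]
    linarith [abs_nonneg a]
  | succ t ih =>
    refine (hstep (t + 1)).trans ?_
    have := mul_le_mul_of_nonneg_left ih hq0
    push_cast
    rw [pow_succ]
    nlinarith [this]

section HeavyBall

variable {F : Type*} [NormedAddCommGroup F] [InnerProductSpace ℝ F]

/-- In an eigenbasis of `H` the error decouples into scalar recurrences with `s = 1 + q² - lam *
ev`. The two conditions on `lam` put `lam * ev` in `[(1 - q)², (1 + q)²]`, which is exactly `|s| ≤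
2q`. -/
theorem heavy_ball_bound [FiniteDimensional ℝ F] {H : F →L[ℝ] F} {lam μ L q : ℝ} {b vh : F}
    {v : ℕ → F} (hsymm : (H : F →ₗ[ℝ] F).IsSymmetric)
    (hlow : ∀ u, μ * ‖u‖ ^ 2 ≤ inner ℝ (H u) u) (hup : ∀ u, inner ℝ (H u) u ≤ L * ‖u‖ ^ 2)
    (hlam : 0 ≤ lam) (hq0 : 0 ≤ q) (hq1 : q ≤ 1)
    (hlamμ : lam * μ = (1 - q) ^ 2) (hlamL : lam * L = (1 + q) ^ 2)
    (hvh : H vh = b) (hv0 : v 0 = 0) (hv1 : v 1 = 0)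
    (hv : ∀ t, v (t + 2) = v (t + 1) - lam • (H (v (t + 1)) - b) + q ^ 2 • (v (t + 1) - v t))
    (t : ℕ) : ‖v (t + 1) - vh‖ ≤ 2 * (t + 2) * q ^ t * ‖vh‖ := by
  let B := hsymm.eigenvectorBasis rfl
  let ev := hsymm.eigenvalues rfl
  have hB : ∀ i, H (B i) = ev i • B i := fun i => hsymm.apply_eigenvectorBasis rfl i
  have hev : ∀ i, μ ≤ ev i ∧ ev i ≤ L := by
    intro i
    have h1 := hlow (B i)
    have h2 := hup (B i)
    rw [hB, real_inner_smul_left, real_inner_self_eq_norm_sq, B.orthonormal.1 i] at h1 h2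
    constructor <;> linarith
  have hcoord : ∀ i, |B.repr (v (t + 1) - vh) i| ≤ 2 * (t + 2) * q ^ t * |B.repr vh i| := by
    intro i
    have hrec := abs_le_of_two_term_recurrence (s := 1 + q ^ 2 - lam * ev i) (q := q)
      (a := - B.repr vh i) (e := fun t => B.repr (v t - vh) i) hq0 hq1 ?_ ?_ ?_ ?_ t
    · rwa [abs_neg] at hrec
    · have h1 := mul_le_mul_of_nonneg_left (hev i).1 hlam
      have h2 := mul_le_mul_of_nonneg_left (hev i).2 hlam
      rw [abs_le]
      constructor <;> nlinarith
    · simp [hv0]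
    · simp [hv1]
    · intro t
      have h1 : B.repr (H (v (t + 1)) - b) i = ev i * B.repr (v (t + 1) - vh) i := by
        rw [← hvh, ← map_sub]
        simpa using hsymm.eigenvectorBasis_apply_self_apply rfl (v (t + 1) - vh) i
      have h2 : v (t + 2) - vh = (v (t + 1) - vh) - lam • (H (v (t + 1)) - b)
          + q ^ 2 • ((v (t + 1) - vh) - (v t - vh)) := by
        rw [hv t]; abel_nf
      simp only []
      rw [h2, map_add, map_sub, map_smul, map_smul, map_sub B.repr (v (t + 1) - vh) (v t - vh)]
      simp only [PiLp.add_apply, PiLp.sub_apply, PiLp.smul_apply, smul_eq_mul, h1]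
      ring
  have hc : 0 ≤ 2 * ((t : ℝ) + 2) * q ^ t := by positivity
  rw [← B.repr.norm_map, ← B.repr.norm_map vh]
  refine le_of_sq_le_sq ?_ (by positivity)
  rw [mul_pow, EuclideanSpace.norm_sq_eq, EuclideanSpace.norm_sq_eq, Finset.mul_sum]
  refine Finset.sum_le_sum fun i _ => ?_
  rw [← mul_pow]
  exact pow_le_pow_left₀ (norm_nonneg _) (hcoord i) 2

end HeavyBall

/-- The contraction factor of the heavy-ball method. -/
noncomputable def hbFactor (Ly' μy : ℝ) : ℝ := (√Ly' - √μy) / (√Ly' + √μy)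

theorem hbFactor_nonneg {Ly' μy : ℝ} (h : μy ≤ Ly') : 0 ≤ hbFactor Ly' μy :=
  div_nonneg (sub_nonneg.2 (Real.sqrt_le_sqrt h)) (by positivity)

theorem hbFactor_le {Ly' μy : ℝ} (hμ : 0 < μy) (h : μy ≤ Ly') :
    hbFactor Ly' μy ≤ 1 - 1 / √(Ly' / μy) := by
  have h1 : 0 < √μy := Real.sqrt_pos.2 hμ
  have h2 : √μy ≤ √Ly' := Real.sqrt_le_sqrt h
  have h3 : 0 < √Ly' := by linarith
  rw [Real.sqrt_div (by linarith), one_div_div, hbFactor, one_sub_div h3.ne',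
    div_le_div_iff₀ (by linarith) h3]
  nlinarith

theorem hbStep_mul_left {Ly' μy : ℝ} (hμ : 0 < μy) :
    hbStep Ly' μy * μy = (1 - hbFactor Ly' μy) ^ 2 := by
  have h1 : 0 < √μy := Real.sqrt_pos.2 hμ
  have h3 : 0 < √Ly' + √μy := by positivity
  have e : 1 - hbFactor Ly' μy = 2 * √μy / (√Ly' + √μy) := by
    rw [hbFactor]; field_simp; ring
  rw [e, hbStep, div_pow, mul_pow, Real.sq_sqrt hμ.le]; ring

theorem hbStep_mul_right {Ly' μy : ℝ} (hμ : 0 < μy) (hL : 0 ≤ Ly') :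
    hbStep Ly' μy * Ly' = (1 + hbFactor Ly' μy) ^ 2 := by
  have h1 : 0 < √μy := Real.sqrt_pos.2 hμ
  have h3 : 0 < √Ly' + √μy := by positivity
  have e : 1 + hbFactor Ly' μy = 2 * √Ly' / (√Ly' + √μy) := by
    rw [hbFactor]; field_simp; ring
  rw [e, hbStep, div_pow, mul_pow, Real.sq_sqrt hL]; ring

theorem hbFactor_le_one {Ly' μy : ℝ} (hμ : 0 < μy) (h : μy ≤ Ly') : hbFactor Ly' μy ≤ 1 := by
  refine (hbFactor_le hμ h).trans ?_
  have : 0 ≤ 1 / √(Ly' / μy) := by positivity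
  linarith

/-- With `q = hbFactor Ly' μy`, the bases of the two squares are `q` and `-q`, so the two entries of
the maximum coincide. -/
theorem hbMomentum_eq {Ly' μy : ℝ} (hμ : 0 < μy) (h : μy ≤ Ly') :
    hbMomentum Ly' μy = hbFactor Ly' μy ^ 2 := by
  have h0 := hbFactor_nonneg h
  have h1 := hbFactor_le_one hμ h
  rw [hbMomentum, hbStep_mul_left hμ, hbStep_mul_right hμ (by linarith),
    Real.sqrt_sq (by linarith), Real.sqrt_sq (by linarith)]
  simp

/-! ### The Hessian, the inner minimizer and the hypergradient. -/

section Bilevel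

variable {E F : Type*}
  [NormedAddCommGroup E] [InnerProductSpace ℝ E] [CompleteSpace E]
  [NormedAddCommGroup F] [InnerProductSpace ℝ F] [CompleteSpace F]
  {f g : E → F → ℝ} {Lx Lxy Ly Lxy' Ly' ρxy ρyy μy : ℝ}

theorem hasGradientAt_gradX (hf : Differentiable ℝ (fun z : E × F => f z.1 z.2)) (x : E) (y : F) :
    HasGradientAt (fun x' => f x' y) (gradX f x y) x := by
  have h1 : DifferentiableAt ℝ (fun x' : E => (x', y)) x := by fun_prop
  exact (DifferentiableAt.comp (g := fun z : E × F => f z.1 z.2) x (hf (x, y)) h1).hasGradientAt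

theorem hasGradientAt_gradY (hf : Differentiable ℝ (fun z : E × F => f z.1 z.2)) (x : E) (y : F) :
    HasGradientAt (f x) (gradY f x y) y := by
  have h1 : DifferentiableAt ℝ (fun y' : F => (x, y')) y := by fun_prop
  exact (DifferentiableAt.comp (g := fun z : E × F => f z.1 z.2) y (hf (x, y)) h1).hasGradientAt

theorem hasFDerivAt_uncurry {G : Type*} [NormedAddCommGroup G] [NormedSpace ℝ G] {φ : E → F → G}
    {x : E} {y : F} (hφ : DifferentiableAt ℝ (fun z : E × F => φ z.1 z.2) (x, y)) :
    HasFDerivAt (fun z : E × F => φ z.1 z.2)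
      ((fderiv ℝ (fun x' => φ x' y) x).coprod (fderiv ℝ (φ x) y)) (x, y) := by
  have h1 : HasFDerivAt (fun x' : E => (x', y)) (ContinuousLinearMap.inl ℝ E F) x :=
    hasFDerivAt_prodMk_left x y
  have h2 : HasFDerivAt (fun y' : F => (x, y')) (ContinuousLinearMap.inr ℝ E F) y :=
    hasFDerivAt_prodMk_right x y
  have h3 := hφ.hasFDerivAt
  have e1 := (HasFDerivAt.comp (g := fun z : E × F => φ z.1 z.2) x h3 h1).fderiv
  have e2 := (HasFDerivAt.comp (g := fun z : E × F => φ z.1 z.2) y h3 h2).fderiv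
  have e : (fderiv ℝ (fun x' => φ x' y) x).coprod (fderiv ℝ (φ x) y)
      = fderiv ℝ (fun z : E × F => φ z.1 z.2) (x, y) := by
    have e1' : fderiv ℝ (fun x' => φ x' y) x = _ := e1
    have e2' : fderiv ℝ (φ x) y = _ := e2
    rw [e1', e2']
    ext u <;> simp
  rw [e]; exact h3

theorem contDiff_gradY (hg : ContDiff ℝ 2 (fun z : E × F => g z.1 z.2)) :
    ContDiff ℝ 1 (fun z : E × F => gradY g z.1 z.2) := by
  have h1 : ContDiff ℝ 1 (fderiv ℝ (fun z : E × F => g z.1 z.2)) :=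
    hg.fderiv_right (by norm_num)
  have hd : Differentiable ℝ (fun z : E × F => g z.1 z.2) := hg.differentiable (by norm_num)
  have e : (fun z : E × F => gradY g z.1 z.2) = fun z : E × F =>
      (InnerProductSpace.toDual ℝ F).symm
        ((fderiv ℝ (fun z : E × F => g z.1 z.2) z).comp (ContinuousLinearMap.inr ℝ E F)) := by
    funext z
    obtain ⟨x, y⟩ := z
    have h2 : HasFDerivAt (fun y' : F => (x, y')) (ContinuousLinearMap.inr ℝ E F) y :=
      hasFDerivAt_prodMk_right x y
    have h3 := (HasFDerivAt.comp (g := fun z : E × F => g z.1 z.2) y (hd (x, y)).hasFDerivAt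
      h2).fderiv
    have h4 : fderiv ℝ (g x) y = _ := h3
    simp only [gradY, gradient]
    rw [← h4]
  rw [e]
  exact (InnerProductSpace.toDual ℝ F).symm.contDiff.comp (h1.clm_comp contDiff_const)

theorem hasFDerivAt_gradY (hg : ContDiff ℝ 2 (fun z : E × F => g z.1 z.2)) (x : E) (y : F) :
    HasFDerivAt (gradY g x) (hessYY g x y) y := by
  have h1 : DifferentiableAt ℝ (fun y' : F => (x, y')) y := by fun_prop
  exact (DifferentiableAt.comp (g := fun z : E × F => gradY g z.1 z.2) y
    ((contDiff_gradY hg).differentiable (by norm_num) (x, y)) h1).hasFDerivAt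

/-- Expresses the Hessian through the second Fréchet derivative, whose symmetry for `C²` functions
then carries over. -/
theorem inner_hessYY (hg : ContDiff ℝ 2 (fun z : E × F => g z.1 z.2)) (x : E) (y u w : F) :
    inner ℝ (hessYY g x y u) w = fderiv ℝ (fderiv ℝ (g x)) y u w := by
  have hx : ContDiff ℝ 2 (g x) := hg.comp (contDiff_prodMk_right x)
  have h1 : DifferentiableAt ℝ (fderiv ℝ (g x)) y :=
    (hx.fderiv_right (m := 1) (by norm_num)).differentiable (by norm_num) y
  have hA := (hasFDerivAt_gradY hg x y).inner ℝ (hasFDerivAt_const w y)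
  have hB := h1.hasFDerivAt.clm_apply (hasFDerivAt_const w y)
  have e : (fun y' => inner ℝ (gradY g x y') w) = fun y' => fderiv ℝ (g x) y' w := by
    funext y'
    rw [gradY, inner_gradient_left]
  rw [e] at hA
  simpa using congrArg (fun T => T u) (hA.unique hB)

theorem isSymmetric_hessYY (hg : ContDiff ℝ 2 (fun z : E × F => g z.1 z.2)) (x : E) (y : F) :
    ((hessYY g x y : F →L[ℝ] F) : F →ₗ[ℝ] F).IsSymmetric := by
  intro u w
  have hx : ContDiff ℝ 2 (g x) := hg.comp (contDiff_prodMk_right x)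
  have h1 : IsSymmSndFDerivAt ℝ (g x) y := hx.contDiffAt.isSymmSndFDerivAt (by simp)
  exact (inner_hessYY hg x y u w).trans ((h1.eq u w).trans
    ((inner_hessYY hg x y w u).symm.trans (real_inner_comm _ _)))

theorem bilevelObj_apply {f g : E → F → ℝ} (x : E) : bilevelObj f g x = f x (yStar g x) := rfl

theorem argminPt_spec {α : Type*} [Nonempty α] {h : α → ℝ} (hh : ∃ a, ∀ b, h a ≤ h b) (b : α) :
    h (argminPt h) ≤ h b :=
  Classical.epsilon_spec (p := fun a => ∀ b, h a ≤ h b) hh b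

/-- A solution `v` of the linear system `∇_y² g (x, y) v = ∇_y f (x, y)`. -/
noncomputable def adjointSol (f g : E → F → ℝ) (x : E) (y : F) : F :=
  Classical.epsilon fun v => hessYY g x y v = gradY f x y

/-- The vector `∇_x f (x, y) - ∇_x ∇_y g (x, y) v`, where `v` solves the linear system. -/
noncomputable def exactHypergrad (f g : E → F → ℝ) (x : E) (y : F) : E :=
  gradX f x y - jacXY g x y (adjointSol f g x y)

namespace IsConvexStronglyConvex

variable (h : IsConvexStronglyConvex f g Lx Lxy Ly Lxy' Ly' ρxy ρyy μy)

include h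

theorem differentiable_f : Differentiable ℝ (fun z : E × F => f z.1 z.2) :=
  h.contDiff_f.differentiable (by norm_num)

theorem differentiable_g : Differentiable ℝ (fun z : E × F => g z.1 z.2) :=
  h.contDiff_g.differentiable (by norm_num)

theorem differentiable_gradY : Differentiable ℝ (fun z : E × F => gradY g z.1 z.2) :=
  (contDiff_gradY h.contDiff_g).differentiable (by norm_num)

theorem norm_hessYY_le (x : E) (y : F) : ‖hessYY g x y‖ ≤ Ly' :=
  (hasFDerivAt_gradY h.contDiff_g x y).le_of_lip' h.Ly'_nonneg
    (Filter.Eventually.of_forall fun y' => h.gradY_g_lip_y x y' y)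

theorem norm_jacXY_le (x : E) (y : F) : ‖jacXY g x y‖ ≤ Lxy' := by
  rw [jacXY, LinearIsometryEquiv.norm_map]
  exact norm_fderiv_le_of_lip' ℝ h.Lxy'_nonneg
    (Filter.Eventually.of_forall fun x' => h.gradY_g_lip_x x' x y)

/-- Limit of the strong monotonicity of `∇_y g` along `y + t • u` as `t` tends to `0` from the
right. -/
theorem mul_sq_norm_le_inner_hessYY (x : E) (y u : F) :
    μy * ‖u‖ ^ 2 ≤ inner ℝ (hessYY g x y u) u := by
  have h1 : HasDerivAt (fun s : ℝ => y + s • u) u 0 := by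
    simpa using ((hasDerivAt_id (0 : ℝ)).smul_const u).const_add y
  have h2 : HasDerivAt (fun s : ℝ => gradY g x (y + s • u)) (hessYY g x y u) 0 :=
    HasFDerivAt.comp_hasDerivAt 0 (by rw [zero_smul, add_zero]; exact hasFDerivAt_gradY h.contDiff_g x y) h1
  have h3 := Filter.Tendsto.inner (𝕜 := ℝ) ((hasDerivAt_iff_tendsto_slope_zero.1 h2).mono_left
    (nhdsWithin_mono (0 : ℝ) (fun t (ht : 0 < t) => ne_of_gt ht) :
      nhdsWithin (0 : ℝ) (Ioi 0) ≤ _)) (tendsto_const_nhds (x := u))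
  refine ge_of_tendsto h3 ?_
  filter_upwards [self_mem_nhdsWithin] with t ht
  have ht : 0 < t := ht
  have h4 := (h.strongConvex_g x).mul_sq_norm_sub_le_inner
    (hasGradientAt_gradY h.differentiable_g x y)
    (hasGradientAt_gradY h.differentiable_g x (y + t • u))
  rw [add_sub_cancel_left, norm_smul, real_inner_smul_right, Real.norm_of_nonneg ht.le] at h4
  simp only [zero_add, zero_smul, add_zero, real_inner_smul_left]
  rw [le_inv_mul_iff₀ ht]
  refine le_of_mul_le_mul_left ?_ ht
  linarith

theorem inner_hessYY_le (x : E) (y u : F) : inner ℝ (hessYY g x y u) u ≤ Ly' * ‖u‖ ^ 2 := by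
  refine (real_inner_le_norm _ _).trans ?_
  rw [pow_two, ← mul_assoc]
  gcongr
  exact (ContinuousLinearMap.le_opNorm _ _).trans
    (mul_le_mul_of_nonneg_right (h.norm_hessYY_le x y) (norm_nonneg _))

theorem mul_norm_le_norm_hessYY (x : E) (y u : F) : μy * ‖u‖ ≤ ‖hessYY g x y u‖ := by
  rcases eq_or_lt_of_le (norm_nonneg u) with h0 | h0
  · rw [← h0]; simp
  · refine le_of_mul_le_mul_right ?_ h0
    have := (h.mul_sq_norm_le_inner_hessYY x y u).trans (real_inner_le_norm _ _)
    nlinarith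

/-- A nonzero vector is essential: its Rayleigh quotient lies between the two constants. This is
where `q ≥ 1` enters. -/
theorem μy_le_Ly' [Nontrivial F] : μy ≤ Ly' := by
  obtain ⟨u, hu⟩ := exists_ne (0 : F)
  have h1 := (h.mul_sq_norm_le_inner_hessYY 0 0 u).trans (h.inner_hessYY_le 0 0 u)
  exact le_of_mul_le_mul_right h1 (by have := norm_pos_iff.2 hu; positivity)

theorem norm_adjoint_le {x : E} {y v b : F} (hv : hessYY g x y v = b) : ‖v‖ ≤ ‖b‖ / μy := by
  rw [le_div_iff₀ h.μy_pos, mul_comm, ← hv]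
  exact h.mul_norm_le_norm_hessYY x y v

variable [FiniteDimensional ℝ F]

theorem hessYY_adjointSol (x : E) (y : F) : hessYY g x y (adjointSol f g x y) = gradY f x y := by
  have hinj : Function.Injective ((hessYY g x y : F →L[ℝ] F) : F →ₗ[ℝ] F) := by
    rw [← LinearMap.ker_eq_bot, LinearMap.ker_eq_bot']
    intro u hu
    have h1 := h.mul_norm_le_norm_hessYY x y u
    rw [ContinuousLinearMap.coe_coe] at hu
    rw [hu, norm_zero] at h1
    have h2 : ‖u‖ ≤ 0 := le_of_mul_le_mul_left (by simpa using h1) h.μy_pos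
    simpa using h2
  exact Classical.epsilon_spec (p := fun v => hessYY g x y v = gradY f x y)
    (LinearMap.injective_iff_surjective.1 hinj (gradY f x y))

theorem norm_adjointSol_le (x : E) (y : F) : ‖adjointSol f g x y‖ ≤ ‖gradY f x y‖ / μy :=
  h.norm_adjoint_le (h.hessYY_adjointSol x y)

theorem yStar_le (x : E) (y : F) : g x (yStar g x) ≤ g x y :=
  argminPt_spec ((h.strongConvex_g x).exists_forall_le h.μy_pos
    fun y => (hasGradientAt_gradY h.differentiable_g x y).differentiableAt) y

theorem gradY_yStar (x : E) : gradY g x (yStar g x) = 0 :=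
  (hasGradientAt_gradY h.differentiable_g x _).eq_zero_of_forall_le (h.yStar_le x)

/-- By strong monotonicity, the distance is controlled by the residual of `y*(x')` in the equation
`∇_y g(x, ·) = 0`; this residual vanishes when `x` is replaced by `x'`. -/
theorem yStar_lipschitz (x x' : E) : ‖yStar g x - yStar g x'‖ ≤ Lxy' / μy * ‖x - x'‖ := by
  have h1 := (h.strongConvex_g x).mul_norm_sub_le
    (hasGradientAt_gradY h.differentiable_g x (yStar g x'))
    (hasGradientAt_gradY h.differentiable_g x (yStar g x))
  rw [h.gradY_yStar x, zero_sub, norm_neg] at h1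
  have h2 := h.gradY_g_lip_x x x' (yStar g x')
  rw [h.gradY_yStar x', sub_zero] at h2
  rw [div_mul_eq_mul_div, le_div_iff₀ h.μy_pos]
  linarith

/-- Implicit differentiation without differentiating `y*`. From the expansion of `f` at `(x, y*(x))`
one subtracts the inner product of `v` with the expansion of `∇_y g`, which vanishes at every `(x',
y*(x'))`. As `∇_y² g v = ∇_y f`, the increments of `y*` cancel. The Lipschitz bound on `y*` makes
the remainders `o(‖x' - x‖)`. -/
theorem hasGradientAt_bilevelObj (x : E) :
    HasGradientAt (bilevelObj f g) (exactHypergrad f g x (yStar g x)) x := by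
  set y := yStar g x with hy
  set v := adjointSol f g x y with hv
  have hK : (fun x' => ((x', yStar g x') : E × F) - (x, y)) =O[nhds x] fun x' => x' - x := by
    rw [Asymptotics.isBigO_iff]
    refine ⟨max 1 (Lxy' / μy), Filter.Eventually.of_forall fun x' => ?_⟩
    rw [Prod.mk_sub_mk, Prod.norm_mk]
    refine max_le ?_ ?_
    · exact le_mul_of_one_le_left (norm_nonneg _) (le_max_left _ _)
    · exact (h.yStar_lipschitz x' x).trans
        (mul_le_mul_of_nonneg_right (le_max_right _ _) (norm_nonneg _))
  have hKt : Filter.Tendsto (fun x' => ((x', yStar g x') : E × F)) (nhds x) (nhds (x, y)) := by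
    rw [tendsto_iff_norm_sub_tendsto_zero]
    have h0 : Filter.Tendsto (fun x' : E => x' - x) (nhds x) (nhds 0) := by
      have : Filter.Tendsto (fun x' : E => x' - x) (nhds x) (nhds (x - x)) :=
        Continuous.tendsto (by fun_prop) x
      simpa using this
    have h1 := (hK.trans_tendsto h0).norm
    rw [norm_zero] at h1
    exact h1
  have hf := ((hasFDerivAt_uncurry (φ := f) (h.differentiable_f (x, y))).isLittleO.comp_tendsto
    hKt).trans_isBigO hK
  have hg := ((hasFDerivAt_uncurry (φ := gradY g) (h.differentiable_gradY (x, y))).isLittleO.comp_tendsto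
    hKt).trans_isBigO hK
  have hg' := ((innerSL ℝ v).isBigO_comp _ (nhds x)).trans_isLittleO hg
  rw [hasGradientAt_iff_isLittleO]
  refine (hf.sub hg').congr_left fun x' => ?_
  have e1 := h.gradY_yStar x
  rw [← hy] at e1
  have e2 := h.gradY_yStar x'
  have e3 : fderiv ℝ (fun x' => f x' y) x (x' - x) = inner ℝ (gradX f x y) (x' - x) := by
    rw [gradX, inner_gradient_left]
  have e4 : fderiv ℝ (f x) y (yStar g x' - y) = inner ℝ (gradY f x y) (yStar g x' - y) := by
    rw [gradY, inner_gradient_left]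
  have e5 : inner ℝ v (hessYY g x y (yStar g x' - y))
      = inner ℝ (gradY f x y) (yStar g x' - y) := by
    rw [← h.hessYY_adjointSol x y]
    exact (isSymmetric_hessYY h.contDiff_g x y v _).symm
  have e6 : inner ℝ v (fderiv ℝ (fun x' => gradY g x' y) x (x' - x))
      = inner ℝ (jacXY g x y v) (x' - x) := by
    rw [jacXY, ContinuousLinearMap.adjoint_inner_left]
  have e7 : fderiv ℝ (gradY g x) y = hessYY g x y := rfl
  simp only [Function.comp, ContinuousLinearMap.coprod_apply, Prod.fst_sub, Prod.snd_sub, e3, e4,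
    e7, innerSL_apply_apply, e1, e2, exactHypergrad, bilevelObj_apply, ← hy, ← hv, sub_zero,
    zero_sub, inner_neg_right, inner_add_right, e5, e6, inner_sub_left]
  ring

theorem differentiable_bilevelObj : Differentiable ℝ (bilevelObj f g) :=
  fun x => (h.hasGradientAt_bilevelObj x).differentiableAt

/-- Perturbation theory for the linear system. The estimate is asymmetric on purpose: `‖∇_y f‖`
occurs only at `(x', y')`, so the other point may be arbitrarily far away. -/
theorem exactHypergrad_sub_le (x x' : E) (y y' : F) :
    ‖exactHypergrad f g x y - exactHypergrad f g x' y'‖ ≤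
      Lx * ‖x - x'‖ + Lxy * ‖y - y'‖ + Lxy' / μy * (Lxy * ‖x - x'‖ + Ly * ‖y - y'‖)
        + (Lxy' * ρyy / μy ^ 2 + ρxy / μy) * √(‖x - x'‖ ^ 2 + ‖y - y'‖ ^ 2)
          * ‖gradY f x' y'‖ := by
  have hμ := h.μy_pos
  set s := √(‖x - x'‖ ^ 2 + ‖y - y'‖ ^ 2) with hs
  have hs0 : 0 ≤ s := Real.sqrt_nonneg _
  set v := adjointSol f g x y
  set v' := adjointSol f g x' y'
  set b := gradY f x y
  set b' := gradY f x' y'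
  have hv : hessYY g x y v = b := h.hessYY_adjointSol x y
  have hv' : hessYY g x' y' v' = b' := h.hessYY_adjointSol x' y'
  have hvn : ‖v'‖ ≤ ‖b'‖ / μy := h.norm_adjointSol_le x' y'
  have hb : ‖b - b'‖ ≤ Lxy * ‖x - x'‖ + Ly * ‖y - y'‖ := by
    have : b - b' = (gradY f x y - gradY f x' y) + (gradY f x' y - gradY f x' y') := by
      simp only [b, b']; abel
    rw [this]
    exact (norm_add_le _ _).trans (add_le_add (h.gradY_f_lip_x _ _ _) (h.gradY_f_lip_y _ _ _))
  have ha : ‖gradX f x y - gradX f x' y'‖ ≤ Lx * ‖x - x'‖ + Lxy * ‖y - y'‖ := by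
    have : gradX f x y - gradX f x' y'
        = (gradX f x y - gradX f x' y) + (gradX f x' y - gradX f x' y') := by abel
    rw [this]
    exact (norm_add_le _ _).trans (add_le_add (h.gradX_f_lip_x _ _ _) (h.gradX_f_lip_y _ _ _))
  have hvv : ‖v - v'‖ ≤ (‖b - b'‖ + ρyy * s * (‖b'‖ / μy)) / μy := by
    -- Subtracting the two systems so that the difference of Hessians acts on `v'`; this is the
    -- source of the asymmetry.
    have e : hessYY g x y (v - v') = (b - b') - (hessYY g x y - hessYY g x' y') v' := by
      rw [map_sub, hv, sub_apply, hv']; abel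
    refine (h.norm_adjoint_le e).trans ?_
    gcongr
    refine (norm_sub_le _ _).trans ?_
    gcongr
    refine (ContinuousLinearMap.le_opNorm _ _).trans ?_
    have := h.hessYY_g_lip x x' y y'
    have h0 := mul_nonneg h.ρyy_nonneg hs0
    gcongr
  have hj : ‖jacXY g x y v - jacXY g x' y' v'‖ ≤
      Lxy' * ((‖b - b'‖ + ρyy * s * (‖b'‖ / μy)) / μy) + ρxy * s * (‖b'‖ / μy) := by
    have e : jacXY g x y v - jacXY g x' y' v'
        = jacXY g x y (v - v') + (jacXY g x y - jacXY g x' y') v' := by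
      rw [map_sub, sub_apply]; abel
    rw [e]
    refine (norm_add_le _ _).trans (add_le_add ?_ ?_)
    · exact (ContinuousLinearMap.le_opNorm _ _).trans
        (mul_le_mul (h.norm_jacXY_le x y) hvv (norm_nonneg _) h.Lxy'_nonneg)
    · exact (ContinuousLinearMap.le_opNorm _ _).trans
        (mul_le_mul (h.jacXY_g_lip x x' y y') hvn (norm_nonneg _) (mul_nonneg h.ρxy_nonneg hs0))
  have e : exactHypergrad f g x y - exactHypergrad f g x' y'
      = (gradX f x y - gradX f x' y') - (jacXY g x y v - jacXY g x' y' v') := by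
    simp only [exactHypergrad, v, v']; abel
  rw [e]
  refine ((norm_sub_le _ _).trans (add_le_add ha hj)).trans ?_
  have h1 : Lxy' / μy * ‖b - b'‖ ≤ Lxy' / μy * (Lxy * ‖x - x'‖ + Ly * ‖y - y'‖) :=
    mul_le_mul_of_nonneg_left hb (div_nonneg h.Lxy'_nonneg hμ.le)
  have h2 : Lxy' * ((‖b - b'‖ + ρyy * s * (‖b'‖ / μy)) / μy) + ρxy * s * (‖b'‖ / μy)
      = Lxy' / μy * ‖b - b'‖ + (Lxy' * ρyy / μy ^ 2 + ρxy / μy) * s * ‖b'‖ := by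
    field_simp
    ring
  linarith

/-- Linear growth of `∇_y f` along `y*`; it replaces a boundedness assumption on `∇_y f`. -/
theorem norm_gradY_yStar_le (x c : E) :
    ‖gradY f x (yStar g x)‖ ≤ ‖gradY f c (yStar g c)‖ + (Lxy + Ly * Lxy' / μy) * ‖x - c‖ := by
  have e : gradY f x (yStar g x) = gradY f c (yStar g c)
      + (gradY f x (yStar g x) - gradY f c (yStar g x))
      + (gradY f c (yStar g x) - gradY f c (yStar g c)) := by abel
  rw [e]
  refine (norm_add₃_le ..).trans ?_
  have h1 := h.gradY_f_lip_x x c (yStar g x)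
  have h2 := h.gradY_f_lip_y c (yStar g x) (yStar g c)
  have h3 := mul_le_mul_of_nonneg_left (h.yStar_lipschitz x c) h.Ly_nonneg
  have e2 : Ly * (Lxy' / μy * ‖x - c‖) = Ly * Lxy' / μy * ‖x - c‖ := by ring
  linarith

/-- The Lipschitz constant of `∇Φ` at a point where `‖∇_y f‖ ≤ b`. -/
theorem gradient_lipschitz_at {c : E} {b : ℝ} (hb : ‖gradY f c (yStar g c)‖ ≤ b) (x : E) :
    ‖exactHypergrad f g x (yStar g x) - exactHypergrad f g c (yStar g c)‖ ≤
      (Lx + 2 * Lxy * Lxy' / μy + Ly * Lxy' ^ 2 / μy ^ 2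
        + (Lxy' * ρyy / μy ^ 2 + ρxy / μy) * (1 + Lxy' / μy) * b) * ‖x - c‖ := by
  have hμ := h.μy_pos
  have hl := h.Lxy'_nonneg
  have hr : 0 ≤ Lxy' * ρyy / μy ^ 2 + ρxy / μy := by
    have := h.ρxy_nonneg; have := h.ρyy_nonneg; positivity
  have hd := h.yStar_lipschitz x c
  set d := ‖yStar g x - yStar g c‖
  have hd0 : 0 ≤ d := norm_nonneg _
  have hr0 := norm_nonneg (x - c)
  have hs : √(‖x - c‖ ^ 2 + d ^ 2) ≤ (1 + Lxy' / μy) * ‖x - c‖ := by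
    rw [Real.sqrt_le_left (by positivity)]
    nlinarith
  refine (h.exactHypergrad_sub_le _ _ _ _).trans ?_
  have h1 : (Lxy' * ρyy / μy ^ 2 + ρxy / μy) * √(‖x - c‖ ^ 2 + d ^ 2) * ‖gradY f c (yStar g c)‖
      ≤ (Lxy' * ρyy / μy ^ 2 + ρxy / μy) * ((1 + Lxy' / μy) * ‖x - c‖) * b := by
    gcongr
  have h2 := mul_le_mul_of_nonneg_left hd h.Lxy_nonneg
  have h3 := mul_le_mul_of_nonneg_left (mul_le_mul_of_nonneg_left hd h.Ly_nonneg)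
    (div_nonneg hl hμ.le)
  have e : (Lx + 2 * Lxy * Lxy' / μy + Ly * Lxy' ^ 2 / μy ^ 2
        + (Lxy' * ρyy / μy ^ 2 + ρxy / μy) * (1 + Lxy' / μy) * b) * ‖x - c‖
      = Lx * ‖x - c‖ + Lxy * (Lxy' / μy * ‖x - c‖) + Lxy' / μy * (Lxy * ‖x - c‖)
        + Lxy' / μy * (Ly * (Lxy' / μy * ‖x - c‖))
        + (Lxy' * ρyy / μy ^ 2 + ρxy / μy) * ((1 + Lxy' / μy) * ‖x - c‖) * b := by
    ring
  rw [e, mul_add (Lxy' / μy)]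
  linarith

end IsConvexStronglyConvex

end Bilevel

/-! ### Oracle counts. -/

section Cost

variable {E F : Type*}
  [NormedAddCommGroup E] [InnerProductSpace ℝ E] [CompleteSpace E]
  [NormedAddCommGroup F] [InnerProductSpace ℝ F] [CompleteSpace F]

theorem innerAGD_cost (g : E → F → ℝ) (Ly' μy : ℝ) (x : E) (t : ℕ) :
    (innerAGD g Ly' μy x t).cost = ⟨t, 0, 0⟩ := by
  induction t with
  | zero => rfl
  | succ t ih => simp [innerAGD, Run.bind, Run.pure, callGradY, ih]

theorem heavyBall_cost (g : E → F → ℝ) (lam θ : ℝ) (x : E) (y b : F) (t : ℕ) :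
    (heavyBall g lam θ x y b t).cost = ⟨0, 0, t⟩ := by
  induction t with
  | zero => rfl
  | succ t ih => simp [heavyBall, Run.bind, Run.pure, callHess, ih]

theorem hypergrad_cost (f g : E → F → ℝ) (Ly' μy : ℝ) (N M : ℕ) (x : E) :
    (hypergrad f g Ly' μy N M x).cost = ⟨N + 2, 1, M⟩ := by
  simp [hypergrad, Run.bind, Run.pure, callGradY, callGradX, callJac, innerAGD_cost,
    heavyBall_cost]

theorem accBiO_cost (f g : E → F → ℝ) (Ly' μy L μx : ℝ) (N M K : ℕ) :
    (accBiO f g Ly' μy L μx N M K).cost = ⟨K * (N + 2), K, K * M⟩ := by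
  induction K with
  | zero => simp [accBiO, Run.pure]
  | succ K ih =>
    simp only [accBiO, Run.bind, Run.pure, ih, hypergrad_cost, OracleCost.mk.injEq]
    refine ⟨by ring, trivial, by ring⟩

end Cost

/-! ### Accuracy of the inner solvers and of the hypergradient estimate. -/

theorem one_sub_inv_pow_le_exp {s : ℝ} (hs : 1 ≤ s) (n : ℕ) :
    (1 - 1 / s) ^ n ≤ Real.exp (-(n / s)) := by
  have h1 : 1 - 1 / s ≤ Real.exp (-(1 / s)) := by
    have := Real.add_one_le_exp (-(1 / s)); linarith
  have h2 : 0 ≤ 1 - 1 / s := by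
    have : 1 / s ≤ 1 := by rw [div_le_one (by linarith)]; exact hs
    linarith
  refine (pow_le_pow_left₀ h2 h1 n).trans (le_of_eq ?_)
  rw [← Real.exp_nat_mul]; congr 1; ring

/-- Half of the exponential rate is given up to absorb the linear factor of the heavy-ball bound. -/
theorem add_two_mul_exp_neg_le {s t : ℝ} (hs : 1 ≤ s) (ht : 0 ≤ t) :
    (t + 2) * Real.exp (-(t / s)) ≤ 2 * (s + 1) * Real.exp (-(t / (2 * s))) := by
  have hs0 : 0 < s := by linarith
  have e : Real.exp (-(t / s)) = Real.exp (-(t / (2 * s))) * Real.exp (-(t / (2 * s))) := by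
    rw [← Real.exp_add]; congr 1; field_simp; ring
  have h1 : t / (2 * s) + 1 ≤ Real.exp (t / (2 * s)) := Real.add_one_le_exp _
  have h2 : Real.exp (t / (2 * s)) * Real.exp (-(t / (2 * s))) = 1 := by
    rw [← Real.exp_add]; simp
  have h3 : t + 2 ≤ 2 * (s + 1) * Real.exp (t / (2 * s)) := by
    have h4 : 1 ≤ Real.exp (t / (2 * s)) := Real.one_le_exp (by positivity)
    have h5 : 2 * s * (t / (2 * s) + 1) = t + 2 * s := by field_simp
    nlinarith
  rw [e, ← mul_assoc]
  refine mul_le_mul_of_nonneg_right ?_ (Real.exp_pos _).le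
  calc (t + 2) * Real.exp (-(t / (2 * s)))
      ≤ 2 * (s + 1) * Real.exp (t / (2 * s)) * Real.exp (-(t / (2 * s))) :=
        mul_le_mul_of_nonneg_right h3 (Real.exp_pos _).le
    _ = 2 * (s + 1) := by rw [mul_assoc, h2, mul_one]

namespace IsConvexStronglyConvex

variable {E F : Type*}
  [NormedAddCommGroup E] [InnerProductSpace ℝ E] [CompleteSpace E]
  [NormedAddCommGroup F] [InnerProductSpace ℝ F] [CompleteSpace F] [FiniteDimensional ℝ F]
  {f g : E → F → ℝ} {Lx Lxy Ly Lxy' Ly' ρxy ρyy μy : ℝ}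
  (h : IsConvexStronglyConvex f g Lx Lxy Ly Lxy' Ly' ρxy ρyy μy)

include h

theorem one_le_sqrt_cond [Nontrivial F] : 1 ≤ √(Ly' / μy) := by
  rw [Real.one_le_sqrt, one_le_div h.μy_pos]; exact h.μy_le_Ly'

theorem norm_innerAGD_sub_le [Nontrivial F] (x : E) (N : ℕ) :
    ‖(innerAGD g Ly' μy x N).val.1 - yStar g x‖ ≤
      2 * √(Ly' / μy) * Real.exp (-(N / (2 * √(Ly' / μy)))) * ‖yStar g x‖ := by
  have hμ := h.μy_pos
  have hL := h.μy_le_Ly'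
  have hs := h.one_le_sqrt_cond
  have hgrad := hasGradientAt_gradY h.differentiable_g x
  have hκ : μy * √(Ly' / μy) ^ 2 = Ly' := by
    rw [Real.sq_sqrt (by have := hμ.trans_le hL; positivity)]; field_simp
  set s := √(Ly' / μy) with hsdef
  set y := yStar g x with hy
  have hdesc : ∀ u w, g x w ≤ g x u + inner ℝ (gradY g x u) (w - u) + Ly' / 2 * ‖w - u‖ ^ 2 :=
    fun u w => le_add_inner_add_of_gradient_lipschitz_at hgrad
      (fun y' => h.gradY_g_lip_y x y' u) w
  set V0 := g x 0 - g x y + μy / 2 * ‖y‖ ^ 2 with hV0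
  have hV0n : 0 ≤ V0 := by
    have h1 := h.yStar_le x 0
    have h2 : 0 ≤ μy / 2 * ‖y‖ ^ 2 := by positivity
    linarith
  have hV0le : V0 ≤ μy * s ^ 2 * ‖y‖ ^ 2 := by
    have h1 := hdesc y 0
    rw [h.gradY_yStar x, inner_zero_left, zero_sub, norm_neg] at h1
    have h2 : μy * ‖y‖ ^ 2 ≤ Ly' * ‖y‖ ^ 2 := by gcongr
    rw [hκ]
    linarith
  -- Gradients are exact here, so `δ = 0`. The descent inequality holds everywhere, and `D` is the
  -- value that makes the energy condition an equality.
  have hconv := (accelerated_inexact (h := g x) (h' := gradY g x) (G := gradY g x) (L := Ly')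
    (m := μy) (D := √(2 / μy * V0)) (δ := 0) (xs := y)
    (z := fun t => (innerAGD g Ly' μy x t).val.1) (x := fun t => (innerAGD g Ly' μy x t).val.2)
    hgrad (h.strongConvex_g x) (h.yStar_le x) hμ hL le_rfl (Real.sqrt_nonneg _) rfl rfl
    (fun _ => rfl)
    (fun t => by
      have e : 1 + (s - 1) / (s + 1) = 2 * s / (s + 1) := by field_simp; ring
      rw [← hsdef, e]; rfl)
    (fun u _ w => hdesc u w) (fun u _ => by simp) (by rw [← hsdef]; simp; positivity)
    (by
      rw [Real.sq_sqrt (by positivity)]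
      refine le_of_eq ?_
      simp only [← hV0]
      field_simp; ring) N).2
  simp only [mul_zero, zero_mul, add_zero, ← hV0, ← hsdef] at hconv
  have hd := (h.strongConvex_g x).sq_dist_le_of_forall_le (hgrad y) (h.yStar_le x)
    (innerAGD g Ly' μy x N).val.1
  have hexp := one_sub_inv_pow_le_exp hs N
  have hexp2 : Real.exp (-(N / s)) = Real.exp (-(N / (2 * s))) ^ 2 := by
    rw [← Real.exp_nat_mul]; congr 1; push_cast; field_simp
  have h1 : (1 - 1 / s) ^ N * V0 ≤ Real.exp (-(N / s)) * (μy * s ^ 2 * ‖y‖ ^ 2) :=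
    mul_le_mul hexp hV0le hV0n (Real.exp_pos _).le
  refine le_of_sq_le_sq ?_ (by positivity)
  have h2 : μy / 2 * ‖(innerAGD g Ly' μy x N).val.1 - y‖ ^ 2
      ≤ μy / 2 * (2 * s ^ 2 * Real.exp (-(N / (2 * s))) ^ 2 * ‖y‖ ^ 2) := by
    rw [hexp2] at h1
    linarith
  have h3 := le_of_mul_le_mul_left h2 (by positivity)
  have h4 : 0 ≤ s ^ 2 * Real.exp (-(N / (2 * s))) ^ 2 * ‖y‖ ^ 2 := by positivity
  have h5 : (2 * s * Real.exp (-(N / (2 * s))) * ‖y‖) ^ 2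
      = 4 * (s ^ 2 * Real.exp (-(N / (2 * s))) ^ 2 * ‖y‖ ^ 2) := by ring
  rw [h5]
  linarith

/-- Because `v⁰ = v¹ = 0`, the first update yields `v²`; hence `M + 1` steps for the exponent `M`.
-/
theorem norm_heavyBall_sub_le [Nontrivial F] (x : E) (y : F) (M : ℕ) :
    ‖(heavyBall g (hbStep Ly' μy) (hbMomentum Ly' μy) x y (gradY f x y) (M + 1)).val.1
        - adjointSol f g x y‖ ≤
      4 * (√(Ly' / μy) + 1) * Real.exp (-(M / (2 * √(Ly' / μy)))) * (‖gradY f x y‖ / μy) := by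
  have hμ := h.μy_pos
  have hL := h.μy_le_Ly'
  have hs := h.one_le_sqrt_cond
  have h1 := heavy_ball_bound (H := hessYY g x y) (lam := hbStep Ly' μy) (μ := μy) (L := Ly')
    (q := hbFactor Ly' μy) (b := gradY f x y) (vh := adjointSol f g x y)
    (v := fun t => (heavyBall g (hbStep Ly' μy) (hbMomentum Ly' μy) x y (gradY f x y) t).val.1)
    (isSymmetric_hessYY h.contDiff_g x y) (h.mul_sq_norm_le_inner_hessYY x y)
    (h.inner_hessYY_le x y) (by unfold hbStep; positivity) (hbFactor_nonneg hL)
    (hbFactor_le_one hμ hL) (hbStep_mul_left hμ) (hbStep_mul_right hμ h.Ly'_nonneg)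
    (h.hessYY_adjointSol x y) rfl rfl (fun t => by rw [← hbMomentum_eq hμ hL]; rfl) M
  refine h1.trans ?_
  have h2 : hbFactor Ly' μy ^ M ≤ Real.exp (-(M / √(Ly' / μy))) :=
    (pow_le_pow_left₀ (hbFactor_nonneg hL) (hbFactor_le hμ hL) M).trans
      (one_sub_inv_pow_le_exp hs M)
  have h3 := add_two_mul_exp_neg_le hs (Nat.cast_nonneg (α := ℝ) M)
  refine mul_le_mul ?_ (h.norm_adjointSol_le x y) (norm_nonneg _) (by positivity)
  have h4 : ((M : ℝ) + 2) * hbFactor Ly' μy ^ M ≤ (M + 2) * Real.exp (-(M / √(Ly' / μy))) := by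
    gcongr
  linarith

/-- Accuracy of the hypergradient estimate in terms of the factor `η` by which the inner solvers
have reduced their errors. -/
theorem norm_hypergrad_sub_le [Nontrivial F] {x : E} {N M : ℕ} {η Y b : ℝ} (hη : η ≤ 1)
    (hN : Real.exp (-(N / (2 * √(Ly' / μy)))) ≤ η) (hM : Real.exp (-(M / (2 * √(Ly' / μy)))) ≤ η)
    (hY : ‖yStar g x‖ ≤ Y) (hb : ‖gradY f x (yStar g x)‖ ≤ b) :
    ‖(hypergrad f g Ly' μy N (M + 1) x).val - exactHypergrad f g x (yStar g x)‖ ≤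
      η * ((Lxy + Lxy' / μy * Ly + (Lxy' * ρyy / μy ^ 2 + ρxy / μy) * b) * (2 * √(Ly' / μy) * Y)
        + Lxy' * (4 * (√(Ly' / μy) + 1) * ((b + Ly * (2 * √(Ly' / μy) * Y)) / μy))) := by
  have hμ := h.μy_pos
  have hs := h.one_le_sqrt_cond
  have hη0 : 0 ≤ η := (Real.exp_pos _).le.trans hN
  have hY0 : 0 ≤ Y := (norm_nonneg _).trans hY
  have hb0 : 0 ≤ b := (norm_nonneg _).trans hb
  have hd := h.norm_innerAGD_sub_le x N
  set s := √(Ly' / μy)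
  set y := (innerAGD g Ly' μy x N).val.1 with hy
  set ys := yStar g x
  have hd' : ‖y - ys‖ ≤ η * (2 * s * Y) := by
    refine hd.trans ?_
    calc 2 * s * Real.exp (-(N / (2 * s))) * ‖ys‖ ≤ 2 * s * η * Y := by gcongr
      _ = η * (2 * s * Y) := by ring
  have hd1 : ‖y - ys‖ ≤ 2 * s * Y := hd'.trans (mul_le_of_le_one_left (by positivity) hη)
  have hbN : ‖gradY f x y‖ ≤ b + Ly * (2 * s * Y) := by
    have e : gradY f x y = gradY f x ys + (gradY f x y - gradY f x ys) := by abel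
    rw [e]
    refine (norm_add_le _ _).trans (add_le_add hb ((h.gradY_f_lip_y x y ys).trans ?_))
    exact mul_le_mul_of_nonneg_left hd1 h.Ly_nonneg
  set v := (heavyBall g (hbStep Ly' μy) (hbMomentum Ly' μy) x y (gradY f x y) (M + 1)).val.1
  have hv : ‖v - adjointSol f g x y‖ ≤ η * (4 * (s + 1) * ((b + Ly * (2 * s * Y)) / μy)) := by
    refine (h.norm_heavyBall_sub_le x y M).trans ?_
    calc 4 * (s + 1) * Real.exp (-(M / (2 * s))) * (‖gradY f x y‖ / μy)
        ≤ 4 * (s + 1) * η * ((b + Ly * (2 * s * Y)) / μy) := by gcongr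
      _ = _ := by ring
  have hval : (hypergrad f g Ly' μy N (M + 1) x).val = gradX f x y - jacXY g x y v := rfl
  -- The error splits into replacing `y*(x)` by `y^N` in the exact formula and solving the linear
  -- system at `y^N` inexactly.
  have e : (hypergrad f g Ly' μy N (M + 1) x).val - exactHypergrad f g x ys
      = (exactHypergrad f g x y - exactHypergrad f g x ys)
        - jacXY g x y (v - adjointSol f g x y) := by
    rw [hval, map_sub]; simp only [exactHypergrad]; abel
  rw [e]
  have h1 := h.exactHypergrad_sub_le x x y ys
  rw [sub_self, norm_zero, zero_pow two_ne_zero, zero_add, Real.sqrt_sq (norm_nonneg _)] at h1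
  have h2 : ‖jacXY g x y (v - adjointSol f g x y)‖
      ≤ Lxy' * (η * (4 * (s + 1) * ((b + Ly * (2 * s * Y)) / μy))) :=
    (ContinuousLinearMap.le_opNorm _ _).trans
      (mul_le_mul (h.norm_jacXY_le x y) hv (norm_nonneg _) h.Lxy'_nonneg)
  refine (norm_sub_le _ _).trans ((add_le_add h1 h2).trans ?_)
  have hr : 0 ≤ Lxy' * ρyy / μy ^ 2 + ρxy / μy := by
    have := h.ρxy_nonneg; have := h.ρyy_nonneg; have := h.Lxy'_nonneg; positivity
  have hl : 0 ≤ Lxy' / μy := div_nonneg h.Lxy'_nonneg hμ.le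
  have h3 : (Lxy' * ρyy / μy ^ 2 + ρxy / μy) * ‖y - ys‖ * ‖gradY f x ys‖
      ≤ (Lxy' * ρyy / μy ^ 2 + ρxy / μy) * (η * (2 * s * Y)) * b := by gcongr
  have h4 := mul_le_mul_of_nonneg_left hd' h.Lxy_nonneg
  have h5 := mul_le_mul_of_nonneg_left (mul_le_mul_of_nonneg_left hd' h.Ly_nonneg) hl
  rw [mul_zero, mul_zero, zero_add, zero_add]
  linarith

end IsConvexStronglyConvex

/-- The radius of a ball around the minimizer of the objective that contains all the iterates `z_k`
of AccBiO. -/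
noncomputable def iterateRadius {E : Type*} [NormedAddCommGroup E] (Φ : E → ℝ) (xs : E)
    (μx ε : ℝ) : ℝ :=
  √(2 / μx * (Φ 0 - Φ xs) + ‖xs‖ ^ 2 + ε / μx)

/-! ### AccBiO for a strongly convex objective. -/

namespace IsConvexStronglyConvex

variable {E F : Type*}
  [NormedAddCommGroup E] [InnerProductSpace ℝ E] [CompleteSpace E] [FiniteDimensional ℝ E]
  [NormedAddCommGroup F] [InnerProductSpace ℝ F] [CompleteSpace F] [FiniteDimensional ℝ F]
  {f g : E → F → ℝ} {Lx Lxy Ly Lxy' Ly' ρxy ρyy μy : ℝ}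
  (h : IsConvexStronglyConvex f g Lx Lxy Ly Lxy' Ly' ρxy ρyy μy)

include h

theorem argmin_bilevelObj_le {μx : ℝ} (hs : StrongConvexOn univ μx (bilevelObj f g)) (hμx : 0 < μx)
    (x : E) : bilevelObj f g (argminPt (bilevelObj f g)) ≤ bilevelObj f g x :=
  argminPt_spec (hs.exists_forall_le hμx h.differentiable_bilevelObj) x

theorem norm_gradY_le_of_mem_ball {c x : E} {D : ℝ} (hx : ‖x - c‖ ≤ 3 * D) :
    ‖gradY f x (yStar g x)‖ ≤ ‖gradY f c (yStar g c)‖ + (Lxy + Ly * Lxy' / μy) * (3 * D) := by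
  have h1 : 0 ≤ Lxy + Ly * Lxy' / μy :=
    add_nonneg h.Lxy_nonneg (div_nonneg (mul_nonneg h.Ly_nonneg h.Lxy'_nonneg) h.μy_pos.le)
  have h2 := mul_le_mul_of_nonneg_left hx h1
  linarith [h.norm_gradY_yStar_le x c]

/-- The factor `3` in `smoothParam` is that of the ball containing the extrapolated points. The
centre lies in this ball, whereas `y` is arbitrary. -/
theorem gradient_lipschitz_smoothParam {μx ε : ℝ} {x : E}
    (hx : ‖x - argminPt (bilevelObj f g)‖ ≤
      3 * iterateRadius (bilevelObj f g) (argminPt (bilevelObj f g)) μx ε) (y : E) :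
    ‖exactHypergrad f g y (yStar g y) - exactHypergrad f g x (yStar g x)‖ ≤
      smoothParam f g Lx Lxy Ly Lxy' ρxy ρyy μy μx ε * ‖y - x‖ := by
  refine (h.gradient_lipschitz_at (h.norm_gradY_le_of_mem_ball hx) y).trans (le_of_eq ?_)
  simp only [smoothParam, iterateRadius]
  ring

theorem accBiO_converges {μx ε δ L : ℝ} {N M : ℕ}
    (hs : StrongConvexOn univ μx (bilevelObj f g)) (hμx : 0 < μx) (hε : 0 < ε) (hδ : 0 ≤ δ)
    (hL : L = smoothParam f g Lx Lxy Ly Lxy' ρxy ρyy μy μx ε) (hμL : μx ≤ L)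
    (hδε : 4 * δ * iterateRadius (bilevelObj f g) (argminPt (bilevelObj f g)) μx ε * √(L / μx) ≤ ε)
    (hG : ∀ x, ‖x - argminPt (bilevelObj f g)‖ ≤
        3 * iterateRadius (bilevelObj f g) (argminPt (bilevelObj f g)) μx ε →
      ‖(hypergrad f g Ly' μy N M x).val - exactHypergrad f g x (yStar g x)‖ ≤ δ) (K : ℕ) :
    ‖(accBiO f g Ly' μy L μx N M K).val.1 - argminPt (bilevelObj f g)‖ ≤
        iterateRadius (bilevelObj f g) (argminPt (bilevelObj f g)) μx ε ∧
      bilevelObj f g (accBiO f g Ly' μy L μx N M K).val.1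
          - bilevelObj f g (argminPt (bilevelObj f g)) ≤
        (1 - 1 / √(L / μx)) ^ K * (bilevelObj f g 0 - bilevelObj f g (argminPt (bilevelObj f g))
          + μx / 2 * ‖argminPt (bilevelObj f g)‖ ^ 2) + ε / 2 := by
  have hlip := fun x hx => h.gradient_lipschitz_smoothParam (μx := μx) (ε := ε) (x := x) hx
  rw [← hL] at hlip
  have hmin := h.argmin_bilevelObj_le hs hμx
  set Φ := bilevelObj f g with hΦ
  set xs := argminPt Φ
  set D := iterateRadius Φ xs μx ε with hD
  have hD0 : 0 ≤ D := Real.sqrt_nonneg _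
  -- The radius is chosen so that the energy budget is the initial energy plus `ε / 2`; the latter
  -- is reserved for the accumulated gradient error.
  have hDsq : μx / 2 * D ^ 2 = Φ 0 - Φ xs + μx / 2 * ‖xs‖ ^ 2 + ε / 2 := by
    have h1 : 0 ≤ Φ 0 - Φ xs := sub_nonneg.2 (hmin 0)
    rw [hD, iterateRadius, Real.sq_sqrt (by positivity)]
    field_simp
  have hgap : 0 ≤ Φ 0 - Φ xs + μx / 2 * ‖xs‖ ^ 2 := by
    have := hmin 0
    have h2 : 0 ≤ μx / 2 * ‖xs‖ ^ 2 := by positivity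
    linarith
  have hDpos : 0 < D := by
    refine lt_of_le_of_ne hD0 fun h0 => ?_
    rw [← h0] at hDsq
    linarith
  -- After multiplication by `D` this follows from `4 δ D √(L/μx) ≤ ε` and `ε ≤ μx * D²`, the latter
  -- by `hDsq`.
  have hδD : 4 * δ * √(L / μx) ≤ μx * D := by
    refine le_of_mul_le_mul_right ?_ hDpos
    nlinarith
  have hmain := accelerated_inexact (h := Φ) (h' := fun x => exactHypergrad f g x (yStar g x))
    (G := fun x => (hypergrad f g Ly' μy N M x).val) (L := L) (m := μx) (D := D) (δ := δ) (xs := xs)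
    (z := fun k => (accBiO f g Ly' μy L μx N M k).val.1)
    (x := fun k => (accBiO f g Ly' μy L μx N M k).val.2)
    h.hasGradientAt_bilevelObj hs hmin hμx hμL hδ hD0 rfl rfl (fun _ => rfl) (fun _ => rfl)
    (fun u hu y => le_add_inner_add_of_gradient_lipschitz_at h.hasGradientAt_bilevelObj
      (hlip u hu) y) hG hδD (by rw [hDsq]; linarith) K
  refine ⟨hmain.1, hmain.2.trans ?_⟩
  linarith

end IsConvexStronglyConvex

namespace IsConvexStronglyConvex

variable {E F : Type*}
  [NormedAddCommGroup E] [InnerProductSpace ℝ E] [CompleteSpace E] [FiniteDimensional ℝ E]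
  [NormedAddCommGroup F] [InnerProductSpace ℝ F] [CompleteSpace F] [FiniteDimensional ℝ F]
  [Nontrivial F]
  {f g : E → F → ℝ} {Lx Lxy Ly Lxy' Ly' ρxy ρyy μy : ℝ}
  (h : IsConvexStronglyConvex f g Lx Lxy Ly Lxy' Ly' ρxy ρyy μy)

include h

/-- If the error constants are at most `ε * Q ^ n`, then `O(√κ √κ_y log ^ 2 Q)` oracle calls are
enough to reach accuracy `ε`. -/
theorem accBiO_complexity {μx ε L Q b Y τ : ℝ} (n : ℕ)
    (hs : StrongConvexOn univ μx (bilevelObj f g)) (hμx : 0 < μx) (hε : 0 < ε) (hτ : 0 ≤ τ)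
    (hL : L = smoothParam f g Lx Lxy Ly Lxy' ρxy ρyy μy μx ε) (hμL : μx ≤ L) (hQ : 2 ≤ Q)
    (hb : ∀ x, ‖x - argminPt (bilevelObj f g)‖ ≤
        3 * iterateRadius (bilevelObj f g) (argminPt (bilevelObj f g)) μx ε →
      ‖gradY f x (yStar g x)‖ ≤ b)
    (hY : ∀ x, ‖x - argminPt (bilevelObj f g)‖ ≤
        3 * iterateRadius (bilevelObj f g) (argminPt (bilevelObj f g)) μx ε → ‖yStar g x‖ ≤ Y)
    (hE : 4 * ((Lxy + Lxy' / μy * Ly + (Lxy' * ρyy / μy ^ 2 + ρxy / μy) * b)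
          * (2 * √(Ly' / μy) * Y)
        + Lxy' * (4 * (√(Ly' / μy) + 1) * ((b + Ly * (2 * √(Ly' / μy) * Y)) / μy)))
      * iterateRadius (bilevelObj f g) (argminPt (bilevelObj f g)) μx ε * √(L / μx) ≤ ε * Q ^ n)
    (hV : 2 * (bilevelObj f g 0 - bilevelObj f g (argminPt (bilevelObj f g))
          + μx / 2 * ‖argminPt (bilevelObj f g)‖ ^ 2) ≤ ε * Q ^ n) :
    ∃ K N M : ℕ,
      ‖(accBiO f g Ly' μy L μx N M K).val.1 - argminPt (bilevelObj f g)‖ ≤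
        iterateRadius (bilevelObj f g) (argminPt (bilevelObj f g)) μx ε ∧
      bilevelObj f g (accBiO f g Ly' μy L μx N M K).val.1
          - bilevelObj f g (argminPt (bilevelObj f g)) ≤ ε ∧
      (accBiO f g Ly' μy L μx N M K).cost.total τ ≤
        (τ + 1) * (n + 2) * (2 * n + 6) * (√(L / μx) * √(Ly' / μy)) * Real.log Q ^ 2 := by
  have hsy := h.one_le_sqrt_cond
  have hκ : 1 ≤ √(L / μx) := by
    rw [Real.one_le_sqrt, one_le_div hμx]; exact hμL
  have hQ0 : 0 < Q := by linarith
  have hmin := h.argmin_bilevelObj_le hs hμx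
  have hlog : 1 / 2 ≤ Real.log Q := by
    have h1 := Real.log_two_gt_d9
    have h2 := Real.log_le_log two_pos hQ
    linarith
  set D := iterateRadius (bilevelObj f g) (argminPt (bilevelObj f g)) μx ε with hD
  have hD0 : 0 ≤ D := Real.sqrt_nonneg _
  set s := √(Ly' / μy)
  set κ := √(L / μx) with hκdef
  have hb0 : 0 ≤ b := (norm_nonneg _).trans (hb (argminPt (bilevelObj f g)) (by simpa using hD0))
  have hY0 : 0 ≤ Y := (norm_nonneg _).trans (hY (argminPt (bilevelObj f g)) (by simpa using hD0))
  set A := (Lxy + Lxy' / μy * Ly + (Lxy' * ρyy / μy ^ 2 + ρxy / μy) * b) * (2 * s * Y)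
        + Lxy' * (4 * (s + 1) * ((b + Ly * (2 * s * Y)) / μy)) with hA
  have hA0 : 0 ≤ A := by
    have := h.μy_pos
    have := h.Lxy_nonneg
    have := h.Ly_nonneg
    have := h.Lxy'_nonneg
    have := h.ρxy_nonneg
    have := h.ρyy_nonneg
    positivity
  have hQn : 0 < Q ^ n := by positivity
  have hQn1 : 1 ≤ Q ^ n := one_le_pow₀ (by linarith)
  have hexpn : Real.exp (-(n * Real.log Q)) = (Q ^ n)⁻¹ := by
    rw [Real.exp_neg, Real.exp_nat_mul, Real.exp_log hQ0]
  -- The counts for which the inner exponential factors and the outer contraction factor `(1 - 1/κ)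
  -- ^ K` drop below `Q⁻ⁿ`. The heavy-ball loop gets `N + 1` steps on account of its index shift.
  let N := ⌈2 * s * (n * Real.log Q)⌉₊
  let K := ⌈κ * (n * Real.log Q)⌉₊
  have hNn : Real.exp (-(N / (2 * s))) ≤ (Q ^ n)⁻¹ := by
    rw [← hexpn, Real.exp_le_exp, neg_le_neg_iff, le_div_iff₀ (by positivity), mul_comm]
    exact Nat.le_ceil _
  have hconv := h.accBiO_converges (N := N) (M := N + 1) (δ := (Q ^ n)⁻¹ * A) hs hμx hε
    (by positivity) hL hμL
    (by
      rw [← hD, ← hκdef]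
      calc 4 * ((Q ^ n)⁻¹ * A) * D * κ = (Q ^ n)⁻¹ * (4 * A * D * κ) := by ring
        _ ≤ (Q ^ n)⁻¹ * (ε * Q ^ n) := mul_le_mul_of_nonneg_left hE (by positivity)
        _ = ε := by field_simp)
    (fun x hx => h.norm_hypergrad_sub_le (inv_le_one_of_one_le₀ hQn1) hNn hNn (hY x hx) (hb x hx)) K
  refine ⟨K, N, N + 1, hconv.1, ?_, ?_⟩
  · refine hconv.2.trans ?_
    set V0 := bilevelObj f g 0 - bilevelObj f g (argminPt (bilevelObj f g))
          + μx / 2 * ‖argminPt (bilevelObj f g)‖ ^ 2 with hV0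
    have hV0n : 0 ≤ V0 := by
      have := hmin 0
      have h2 : 0 ≤ μx / 2 * ‖argminPt (bilevelObj f g)‖ ^ 2 := by positivity
      linarith
    have h1 : (1 - 1 / κ) ^ K ≤ (Q ^ n)⁻¹ := by
      refine (one_sub_inv_pow_le_exp hκ K).trans ?_
      rw [← hexpn, Real.exp_le_exp, neg_le_neg_iff, le_div_iff₀ (by positivity), mul_comm]
      exact Nat.le_ceil _
    have h2 : (1 - 1 / κ) ^ K * V0 ≤ (Q ^ n)⁻¹ * (ε * Q ^ n / 2) :=
      mul_le_mul h1 (by linarith) hV0n (by positivity)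
    have h3 : (Q ^ n)⁻¹ * (ε * Q ^ n / 2) = ε / 2 := by field_simp
    linarith
  · rw [accBiO_cost, OracleCost.total]
    push_cast
    have hn0 : 0 ≤ n * Real.log Q := by positivity
    -- The roundings are absorbed by `1 ≤ 2 κ log Q` and `1 ≤ 2 s log Q`, which hold because `Q ≥
    -- 2`.
    have hK : (K : ℝ) ≤ (n + 2) * (κ * Real.log Q) := by
      have h1 := (Nat.ceil_lt_add_one (show 0 ≤ κ * (n * Real.log Q) by positivity)).le
      have h2 : 1 / 2 ≤ κ * Real.log Q := by nlinarith
      linarith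
    have hN : (N : ℝ) + 2 ≤ (2 * n + 6) * (s * Real.log Q) := by
      have h1 := (Nat.ceil_lt_add_one (show 0 ≤ 2 * s * (n * Real.log Q) by positivity)).le
      have h2 : 1 / 2 ≤ s * Real.log Q := by nlinarith
      linarith
    calc τ * ((K : ℝ) + K * (N + 1)) + K * (N + 2) = (τ + 1) * (K * (N + 2)) := by ring
      _ ≤ (τ + 1) * (((n + 2) * (κ * Real.log Q)) * ((2 * n + 6) * (s * Real.log Q))) := by
        gcongr
      _ = _ := by ring

end IsConvexStronglyConvex

/-- The Lipschitz constant of `∇Φ` at a point where `‖∇_y f‖ ≤ b`. -/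
noncomputable def gradLipConst (Lx Lxy Ly Lxy' ρxy ρyy μy b : ℝ) : ℝ :=
  Lx + 2 * Lxy * Lxy' / μy + Ly * Lxy' ^ 2 / μy ^ 2
    + (Lxy' * ρyy / μy ^ 2 + ρxy / μy) * (1 + Lxy' / μy) * b

/-- Since `1 ≤ ℓ / μy`, missing powers of `1 / μy` can be inserted at the price of powers of `ℓ`,
until all terms share the worst exponents. -/
theorem gradLipConst_le {Lx Lxy Ly Lxy' ρxy ρyy μy b ℓ : ℝ} (hℓ : 1 ≤ ℓ) (hLx : Lx ≤ ℓ)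
    (hLxy : Lxy ≤ ℓ) (hLy : Ly ≤ ℓ) (hLxy' : Lxy' ≤ ℓ) (hμℓ : μy ≤ ℓ)
    (hLxy'0 : 0 ≤ Lxy') (hρxy : 0 ≤ ρxy) (hρyy : 0 ≤ ρyy) (hμ : 0 < μy) (hb : 0 ≤ b) :
    gradLipConst Lx Lxy Ly Lxy' ρxy ρyy μy b ≤
      4 * ℓ ^ 3 * (1 / μy ^ 2) + 2 * ℓ ^ 2 * (ρyy / μy ^ 3 + ρxy / μy ^ 2) * b := by
  simp only [gradLipConst, div_eq_mul_inv, ← inv_pow, one_mul]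
  set u := μy⁻¹ with hu
  have hu0 : 0 < u := by positivity
  have hℓu : 1 ≤ ℓ * u := by
    rw [hu, ← div_eq_mul_inv, one_le_div hμ]; exact hμℓ
  have h1 : ℓ ≤ ℓ ^ 3 * u ^ 2 := by
    calc ℓ = ℓ * 1 ^ 2 := by ring
      _ ≤ ℓ * (ℓ * u) ^ 2 := by gcongr
      _ = _ := by ring
  have h2 : 2 * Lxy * Lxy' * u ≤ 2 * ℓ ^ 3 * u ^ 2 := by
    calc 2 * Lxy * Lxy' * u ≤ 2 * ℓ * ℓ * u * 1 := by rw [mul_one]; gcongr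
      _ ≤ 2 * ℓ * ℓ * u * (ℓ * u) := by gcongr
      _ = _ := by ring
  have h3 : Ly * Lxy' ^ 2 * u ^ 2 ≤ ℓ ^ 3 * u ^ 2 := by
    calc Ly * Lxy' ^ 2 * u ^ 2 ≤ ℓ * ℓ ^ 2 * u ^ 2 := by gcongr
      _ = _ := by ring
  have h4 : (Lxy' * ρyy * u ^ 2 + ρxy * u) * (1 + Lxy' * u) * b
      ≤ 2 * ℓ ^ 2 * (ρyy * u ^ 3 + ρxy * u ^ 2) * b := by
    apply mul_le_mul_of_nonneg_right _ hb
    calc (Lxy' * ρyy * u ^ 2 + ρxy * u) * (1 + Lxy' * u)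
        ≤ (ℓ * ρyy * u ^ 2 + ℓ * (ρxy * u)) * (ℓ * u + ℓ * u) := by
          have e : ρxy * u ≤ ℓ * (ρxy * u) := le_mul_of_one_le_left (by positivity) hℓ
          refine mul_le_mul (add_le_add (by gcongr) e) (add_le_add hℓu (by gcongr))
            (by positivity) (by positivity)
      _ = _ := by ring
  linarith

/-! ### The regularized problem. -/

section Regularize

variable {E F : Type*}
  [NormedAddCommGroup E] [InnerProductSpace ℝ E] [CompleteSpace E]
  [NormedAddCommGroup F] [InnerProductSpace ℝ F] [CompleteSpace F]
  {f g : E → F → ℝ} {Lx Lxy Ly Lxy' Ly' ρxy ρyy μy : ℝ}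

theorem smoothParam_eq (f g : E → F → ℝ) (Lx Lxy Ly Lxy' ρxy ρyy μy μx ε : ℝ) :
    smoothParam f g Lx Lxy Ly Lxy' ρxy ρyy μy μx ε = gradLipConst Lx Lxy Ly Lxy' ρxy ρyy μy
      (‖gradY f (argminPt (bilevelObj f g)) (yStar g (argminPt (bilevelObj f g)))‖
        + (Lxy + Ly * Lxy' / μy)
          * (3 * iterateRadius (bilevelObj f g) (argminPt (bilevelObj f g)) μx ε)) := by
  simp only [smoothParam, gradLipConst, iterateRadius]
  ring

theorem gradY_regularize (f : E → F → ℝ) (c : ℝ) : gradY (regularize f c) = gradY f := by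
  funext x y
  simp only [gradY, gradient, regularize, fderiv_add_const]

theorem hasGradientAt_mul_sq_norm (c : ℝ) (x : E) :
    HasGradientAt (fun x : E => c / 2 * ‖x‖ ^ 2) (c • x) x := by
  rw [hasGradientAt_iff_hasFDerivAt]
  have h1 := ((hasStrictFDerivAt_norm_sq x).hasFDerivAt).const_mul (c / 2)
  refine h1.congr_fderiv ?_
  ext u
  simp only [smul_apply, innerSL_apply_apply, InnerProductSpace.toDual_apply_apply,
    real_inner_smul_left, smul_eq_mul, nsmul_eq_mul]
  push_cast; ring

theorem bilevelObj_regularize (f g : E → F → ℝ) (c : ℝ) :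
    bilevelObj (regularize f c) g = fun x => bilevelObj f g x + c / 2 * ‖x‖ ^ 2 := rfl

namespace IsConvexStronglyConvex

variable (h : IsConvexStronglyConvex f g Lx Lxy Ly Lxy' Ly' ρxy ρyy μy)

include h

theorem gradX_regularize (c : ℝ) (x : E) (y : F) :
    gradX (regularize f c) x y = gradX f x y + c • x := by
  have h1 := hasGradientAt_iff_hasFDerivAt.1 (hasGradientAt_gradX h.differentiable_f x y)
  have h2 := hasGradientAt_iff_hasFDerivAt.1 (hasGradientAt_mul_sq_norm c x)
  have h3 : HasGradientAt (fun x' => regularize f c x' y) (gradX f x y + c • x) x := by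
    rw [hasGradientAt_iff_hasFDerivAt, map_add]
    exact h1.add h2
  exact h3.gradient

theorem exactHypergrad_regularize (c : ℝ) (x : E) (y : F) :
    exactHypergrad (regularize f c) g x y = exactHypergrad f g x y + c • x := by
  simp only [exactHypergrad, adjointSol, gradY_regularize, h.gradX_regularize]
  abel

theorem add_regularization {c : ℝ} (hc : 0 ≤ c) :
    IsConvexStronglyConvex (regularize f c) g (Lx + c) Lxy Ly Lxy' Ly' ρxy ρyy μy where
  contDiff_f := h.contDiff_f.add (contDiff_const.mul (contDiff_fst.norm_sq ℝ))
  contDiff_g := h.contDiff_g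
  Lx_nonneg := add_nonneg h.Lx_nonneg hc
  Lxy_nonneg := h.Lxy_nonneg
  Ly_nonneg := h.Ly_nonneg
  Lxy'_nonneg := h.Lxy'_nonneg
  Ly'_nonneg := h.Ly'_nonneg
  ρxy_nonneg := h.ρxy_nonneg
  ρyy_nonneg := h.ρyy_nonneg
  μy_pos := h.μy_pos
  gradX_f_lip_x := fun x₁ x₂ y => by
    have e : gradX f x₁ y + c • x₁ - (gradX f x₂ y + c • x₂)
        = (gradX f x₁ y - gradX f x₂ y) + c • (x₁ - x₂) := by module
    rw [h.gradX_regularize, h.gradX_regularize, e, add_mul]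
    refine (norm_add_le _ _).trans (add_le_add (h.gradX_f_lip_x _ _ _) ?_)
    rw [norm_smul, Real.norm_of_nonneg hc]
  gradX_f_lip_y := fun x y₁ y₂ => by
    rw [h.gradX_regularize, h.gradX_regularize, add_sub_add_right_eq_sub]
    exact h.gradX_f_lip_y _ _ _
  gradY_f_lip_x := by rw [gradY_regularize]; exact h.gradY_f_lip_x
  gradY_f_lip_y := by rw [gradY_regularize]; exact h.gradY_f_lip_y
  gradY_g_lip_x := h.gradY_g_lip_x
  gradY_g_lip_y := h.gradY_g_lip_y
  jacXY_g_lip := h.jacXY_g_lip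
  hessYY_g_lip := h.hessYY_g_lip
  strongConvex_g := h.strongConvex_g
  convex_obj := (StrongConvexOn.add_mul_sq_norm h.convex_obj).mono hc |> strongConvexOn_zero.1

theorem strongConvexOn_regularize (c : ℝ) :
    StrongConvexOn univ c (bilevelObj (regularize f c) g) :=
  StrongConvexOn.add_mul_sq_norm h.convex_obj

variable [FiniteDimensional ℝ E] [FiniteDimensional ℝ F] {xs : E}
  (hxs : ∀ x, bilevelObj f g xs ≤ bilevelObj f g x)

include hxs

/-- Each of the two minimizers is tested in the optimality of the other; the values of `Φ` cancel
and the squared norms remain. -/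
theorem norm_argmin_regularize_le {c : ℝ} (hc : 0 < c) :
    ‖argminPt (bilevelObj (regularize f c) g)‖ ≤ ‖xs‖ := by
  have h1 := (h.add_regularization hc.le).argmin_bilevelObj_le (h.strongConvexOn_regularize c) hc xs
  simp only [bilevelObj_regularize] at h1 ⊢
  set xt := argminPt (fun x => bilevelObj f g x + c / 2 * ‖x‖ ^ 2)
  have h2 := hxs xt
  refine le_of_sq_le_sq ?_ (norm_nonneg _)
  exact le_of_mul_le_mul_left (a := c / 2) (by linarith) (by positivity)

theorem regularize_gap_le {c : ℝ} (hc : 0 < c) :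
    bilevelObj (regularize f c) g 0
        - bilevelObj (regularize f c) g (argminPt (bilevelObj (regularize f c) g))
      ≤ bilevelObj f g 0 - bilevelObj f g xs := by
  simp only [bilevelObj_regularize]
  set xt := argminPt (fun x => bilevelObj f g x + c / 2 * ‖x‖ ^ 2)
  have h2 := hxs xt
  have h3 : 0 ≤ c / 2 * ‖xt‖ ^ 2 := by positivity
  rw [norm_zero]
  linarith

/-- The square of the radius is at most `2a² + 2‖xs‖²` with `a = √(R Δ0 / ε)`. The condition on `√R`
bounds `a` by the last term of `μy * deltaCSC`; it holds for `R = B²` and for `R = B`, which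
explains the factor `‖x*‖ + 1` in `Δ*`. -/
theorem iterateRadius_regularize_le {ε R ε' : ℝ} (hε : 0 < ε) (hR : 0 < R)
    (hRB : √R ≤ ‖xs‖ + 1) (hε' : ε' / (ε / R) ≤ ‖xs‖ ^ 2) :
    iterateRadius (bilevelObj (regularize f (ε / R)) g)
        (argminPt (bilevelObj (regularize f (ε / R)) g)) (ε / R) ε'
      ≤ 2 * (μy * deltaCSC f g xs μy ε) := by
  have hμ := h.μy_pos
  have hc : 0 < ε / R := by positivity
  have h1 := h.norm_argmin_regularize_le hxs hc
  have h2 := h.regularize_gap_le hxs hc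
  have h3 : 0 ≤ bilevelObj f g 0 - bilevelObj f g xs := sub_nonneg.2 (hxs 0)
  set Δ0 := bilevelObj f g 0 - bilevelObj f g xs with hΔ0
  have h4 : 2 / (ε / R) * Δ0 = 2 * (√R * √Δ0 / √ε) ^ 2 := by
    rw [div_pow, mul_pow, Real.sq_sqrt hR.le, Real.sq_sqrt h3, Real.sq_sqrt hε.le]
    field_simp
  have h5 : μy * deltaCSC f g xs μy ε
      = μy * ‖gradY f xs (yStar g xs)‖ + ‖xs‖ + (‖xs‖ + 1) * √Δ0 / √ε := by
    have : √ε ≠ 0 := (Real.sqrt_pos.2 hε).ne'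
    rw [deltaCSC, ← hΔ0]; field_simp
  have h6 : √R * √Δ0 / √ε ≤ (‖xs‖ + 1) * √Δ0 / √ε := by gcongr
  have h7 : 0 ≤ μy * ‖gradY f xs (yStar g xs)‖ := by positivity
  have h8 : 0 ≤ √R * √Δ0 / √ε := by positivity
  rw [iterateRadius, h5, Real.sqrt_le_left (by positivity)]
  set a := √R * √Δ0 / √ε
  have h9 : 2 / (ε / R) * (bilevelObj (regularize f (ε / R)) g 0
      - bilevelObj (regularize f (ε / R)) g
        (argminPt (bilevelObj (regularize f (ε / R)) g))) ≤ 2 * a ^ 2 := by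
    rw [← h4]; gcongr
  have h10 : ‖argminPt (bilevelObj (regularize f (ε / R)) g)‖ ^ 2 ≤ ‖xs‖ ^ 2 := by gcongr
  have h11 : 2 * a ^ 2 + ‖xs‖ ^ 2 + ‖xs‖ ^ 2 ≤ (2 * (‖xs‖ + a)) ^ 2 := by
    nlinarith [norm_nonneg xs]
  refine le_trans ?_ (h11.trans (pow_le_pow_left₀ (by positivity) ?_ 2))
  · linarith
  · linarith

end IsConvexStronglyConvex

end Regularize

/-- The number `a` is nonnegative and at most `Q ^ n`. -/
def IsPowBounded (Q : ℝ) (n : ℕ) (a : ℝ) : Prop := 0 ≤ a ∧ a ≤ Q ^ n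

/-! ### Bookkeeping of polynomial bounds. -/

namespace IsPowBounded

variable {Q a b : ℝ} {m n : ℕ}

theorem mono (ha : IsPowBounded Q m a) (hQ : 2 ≤ Q) (hmn : m ≤ n) : IsPowBounded Q n a :=
  ⟨ha.1, ha.2.trans (pow_le_pow_right₀ (by linarith) hmn)⟩

theorem mul (ha : IsPowBounded Q m a) (hb : IsPowBounded Q n b) :
    IsPowBounded Q (m + n) (a * b) :=
  ⟨mul_nonneg ha.1 hb.1, by
    rw [pow_add]; exact mul_le_mul ha.2 hb.2 hb.1 (ha.1.trans ha.2)⟩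

/-- The extra exponent pays for the factor `2 ≤ Q` in `2 Q ^ max m n`. -/
theorem add (ha : IsPowBounded Q m a) (hb : IsPowBounded Q n b) (hQ : 2 ≤ Q) :
    IsPowBounded Q (max m n + 1) (a + b) := by
  refine ⟨add_nonneg ha.1 hb.1, ?_⟩
  have h1 := (ha.mono hQ (le_max_left m n)).2
  have h2 := (hb.mono hQ (le_max_right m n)).2
  have h3 : 0 ≤ Q ^ max m n := ha.1.trans h1
  rw [pow_succ]
  nlinarith

theorem pow (ha : IsPowBounded Q m a) (k : ℕ) : IsPowBounded Q (m * k) (a ^ k) :=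
  ⟨pow_nonneg ha.1 k, by rw [pow_mul]; exact pow_le_pow_left₀ ha.1 ha.2 k⟩

theorem div (ha : IsPowBounded Q m a) (hb : IsPowBounded Q n (1 / b)) :
    IsPowBounded Q (m + n) (a / b) := by
  rw [div_eq_mul_one_div]; exact ha.mul hb

theorem sqrt (ha : IsPowBounded Q m a) (hQ : 2 ≤ Q) : IsPowBounded Q m √a := by
  have h1 : 1 ≤ Q ^ m := one_le_pow₀ (by linarith)
  refine ⟨Real.sqrt_nonneg a, ?_⟩
  rw [Real.sqrt_le_left (by linarith)]
  nlinarith [ha.2]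

theorem of_le_two_pow (ha : 0 ≤ a) (hQ : 2 ≤ Q) (ham : a ≤ 2 ^ m) : IsPowBounded Q m a :=
  ⟨ha, ham.trans (pow_le_pow_left₀ (by norm_num) hQ m)⟩

end IsPowBounded

/-- Both sides are squared; a sum of squares of nonnegative numbers is at most the square of their
sum. The constant `49` is a perfect square, with root `7`. -/
theorem sqrt_cond_mul_le {ε R L ℓ Ly' ρxy ρyy μy Δ : ℝ} (hε : 0 < ε) (hR : 0 < R) (hμ : 0 < μy)
    (hρyy : 0 ≤ ρyy) (hρxy : 0 ≤ ρxy) (hLy' : 0 ≤ Ly') (hΔ : 0 ≤ Δ) (hL : 0 < L)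
    (hLle : L ≤ 49 * ℓ ^ 4 * (1 / μy ^ 2 + (ρyy / μy ^ 3 + ρxy / μy ^ 2) * Δ)) :
    √(L / (ε / R)) * √(Ly' / μy) ≤ 7 * ℓ ^ 2 * (√(R * Ly' / (ε * μy ^ 3))
      + (√(R * ρyy * Ly' / (ε * μy ^ 4)) + √(R * ρxy * Ly' / (ε * μy ^ 3))) * √Δ) := by
  have hX2 : √(R * Ly' / (ε * μy ^ 3)) ^ 2 = R * Ly' / (ε * μy ^ 3) :=
    Real.sq_sqrt (by positivity)
  have hY2 : √(R * ρyy * Ly' / (ε * μy ^ 4)) ^ 2 = R * ρyy * Ly' / (ε * μy ^ 4) :=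
    Real.sq_sqrt (by positivity)
  have hZ2 : √(R * ρxy * Ly' / (ε * μy ^ 3)) ^ 2 = R * ρxy * Ly' / (ε * μy ^ 3) :=
    Real.sq_sqrt (by positivity)
  have hX0 : 0 ≤ √(R * Ly' / (ε * μy ^ 3)) := Real.sqrt_nonneg _
  have hY0 : 0 ≤ √(R * ρyy * Ly' / (ε * μy ^ 4)) := Real.sqrt_nonneg _
  have hZ0 : 0 ≤ √(R * ρxy * Ly' / (ε * μy ^ 3)) := Real.sqrt_nonneg _
  have h5 : 49 * ℓ ^ 4 * (1 / μy ^ 2 + (ρyy / μy ^ 3 + ρxy / μy ^ 2) * Δ) / (ε / R) * (Ly' / μy)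
      = 49 * ℓ ^ 4 * (R * Ly' / (ε * μy ^ 3)
        + (R * ρyy * Ly' / (ε * μy ^ 4) + R * ρxy * Ly' / (ε * μy ^ 3)) * Δ) := by
    field_simp
  have h4 : L / (ε / R) * (Ly' / μy) ≤ 49 * ℓ ^ 4 * (1 / μy ^ 2
      + (ρyy / μy ^ 3 + ρxy / μy ^ 2) * Δ) / (ε / R) * (Ly' / μy) := by gcongr
  have hΔ2 : √Δ ^ 2 = Δ := Real.sq_sqrt hΔ
  have hΔ0 : 0 ≤ √Δ := Real.sqrt_nonneg _
  rw [h5, ← hX2, ← hY2, ← hZ2] at h4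
  set X := √(R * Ly' / (ε * μy ^ 3))
  set Y := √(R * ρyy * Ly' / (ε * μy ^ 4))
  set Z := √(R * ρxy * Ly' / (ε * μy ^ 3))
  rw [← Real.sqrt_mul (by positivity), Real.sqrt_le_left (by positivity)]
  have h6 : X ^ 2 + (Y ^ 2 + Z ^ 2) * Δ ≤ (X + (Y + Z) * √Δ) ^ 2 := by
    have h7 : 0 ≤ X * ((Y + Z) * √Δ) := by positivity
    have h8 : 0 ≤ Y * Z * √Δ ^ 2 := by positivity
    have h9 : (Y ^ 2 + Z ^ 2) * Δ = (Y ^ 2 + Z ^ 2) * √Δ ^ 2 := by rw [hΔ2]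
    linarith
  calc L / (ε / R) * (Ly' / μy) ≤ 49 * ℓ ^ 4 * (X ^ 2 + (Y ^ 2 + Z ^ 2) * Δ) := h4
    _ ≤ 49 * ℓ ^ 4 * (X + (Y + Z) * √Δ) ^ 2 := by gcongr
    _ = _ := by ring

/-- Removes `ℓ` from the logarithm at the cost of a factor that depends on `ℓ` alone. -/
theorem log_mul_le_mul_log {ℓ P : ℝ} (hℓ : 1 ≤ ℓ) (hP : 2 ≤ P) :
    Real.log (ℓ * P) ≤ (1 + Real.log ℓ / Real.log 2) * Real.log P := by
  have hlog2 : 0 < Real.log 2 := Real.log_pos (by norm_num)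
  have h1 : Real.log ℓ ≤ Real.log ℓ / Real.log 2 * Real.log P := by
    rw [div_mul_eq_mul_div, le_div_iff₀ hlog2]
    exact mul_le_mul_of_nonneg_left (Real.log_le_log two_pos hP) (Real.log_nonneg hℓ)
  rw [Real.log_mul (by linarith) (by linarith)]
  linarith

/-! ### Complexity of the regularized problem in terms of `Δ*`. -/

namespace IsConvexStronglyConvex

variable {E F : Type*}
  [NormedAddCommGroup E] [InnerProductSpace ℝ E] [CompleteSpace E] [FiniteDimensional ℝ E]
  [NormedAddCommGroup F] [InnerProductSpace ℝ F] [CompleteSpace F] [FiniteDimensional ℝ F]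
  {f g : E → F → ℝ} {Lx Lxy Ly Lxy' Ly' ρxy ρyy μy : ℝ}
  (h : IsConvexStronglyConvex f g Lx Lxy Ly Lxy' Ly' ρxy ρyy μy) {xs : E}
  (hxs : ∀ x, bilevelObj f g xs ≤ bilevelObj f g x)

include h hxs

theorem deltaCSC_bounds {ε : ℝ} :
    ‖gradY f xs (yStar g xs)‖ ≤ deltaCSC f g xs μy ε ∧ ‖xs‖ ≤ μy * deltaCSC f g xs μy ε := by
  have hμ := h.μy_pos
  have h1 : 0 ≤ (‖xs‖ + 1) * √(bilevelObj f g 0 - bilevelObj f g xs) / (√ε * μy) := by positivity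
  have h2 : 0 ≤ ‖xs‖ / μy := by positivity
  have h3 : ‖xs‖ / μy ≤ deltaCSC f g xs μy ε := by
    rw [deltaCSC]; linarith [norm_nonneg (gradY f xs (yStar g xs))]
  refine ⟨by rw [deltaCSC]; linarith, ?_⟩
  rwa [div_le_iff₀ hμ, mul_comm] at h3

/-- The constant is `8 = 3 * 2 + 1 + 1`: the radius bound, then the norms of the regularized
minimizer and of `xs`. -/
theorem norm_sub_le_of_mem_ball {ε R ε' : ℝ} (hε : 0 < ε) (hR : 0 < R)
    (hRB : √R ≤ ‖xs‖ + 1) (hε' : ε' / (ε / R) ≤ ‖xs‖ ^ 2) {x : E}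
    (hx : ‖x - argminPt (bilevelObj (regularize f (ε / R)) g)‖ ≤
      3 * iterateRadius (bilevelObj (regularize f (ε / R)) g)
        (argminPt (bilevelObj (regularize f (ε / R)) g)) (ε / R) ε') :
    ‖x - xs‖ ≤ 8 * (μy * deltaCSC f g xs μy ε) := by
  have h1 := h.iterateRadius_regularize_le hxs hε hR hRB hε'
  have h2 := h.norm_argmin_regularize_le hxs (show 0 < ε / R by positivity)
  have h3 := (h.deltaCSC_bounds hxs (ε := ε)).2
  set xt := argminPt (bilevelObj (regularize f (ε / R)) g)
  have h4 : ‖x - xs‖ ≤ ‖x - xt‖ + (‖xt‖ + ‖xs‖) := by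
    have e : x - xs = (x - xt) + (xt - xs) := by abel
    rw [e]
    exact (norm_add_le _ _).trans (add_le_add le_rfl (norm_sub_le _ _))
  linarith

/-- The factor `μy` in the distance cancels the `1 / μy` of the Lipschitz constant of `y*`, so no
negative power of `μy` is left; `17 = 1 + 8 + 8`. -/
theorem norm_gradY_le_of_norm_sub_le {ε ℓ : ℝ} (hℓ : 1 ≤ ℓ) (hLxy : Lxy ≤ ℓ) (hLy : Ly ≤ ℓ)
    (hLxy' : Lxy' ≤ ℓ) (hμℓ : μy ≤ ℓ) {x : E}
    (hx : ‖x - xs‖ ≤ 8 * (μy * deltaCSC f g xs μy ε)) :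
    ‖gradY f x (yStar g x)‖ ≤ 17 * ℓ ^ 2 * deltaCSC f g xs μy ε := by
  have hμ := h.μy_pos
  obtain ⟨h1, -⟩ := h.deltaCSC_bounds hxs (ε := ε)
  set Δ := deltaCSC f g xs μy ε
  have hΔ : 0 ≤ Δ := (norm_nonneg _).trans h1
  have h2 := h.norm_gradY_yStar_le x xs
  have hLxy'0 := h.Lxy'_nonneg
  have hLxy0 := h.Lxy_nonneg
  have hLy0 := h.Ly_nonneg
  have h3 : (Lxy + Ly * Lxy' / μy) * ‖x - xs‖ ≤ (ℓ + ℓ * ℓ / μy) * (8 * (μy * Δ)) := by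
    gcongr
  have h4 : (ℓ + ℓ * ℓ / μy) * (8 * (μy * Δ)) = 8 * (ℓ * μy * Δ + ℓ * ℓ * Δ) := by
    field_simp
  have h5 : ℓ * μy * Δ ≤ ℓ * ℓ * Δ := by gcongr
  have h6 : Δ ≤ ℓ * ℓ * Δ := le_mul_of_one_le_left hΔ (by nlinarith)
  linarith

/-- Hypothesis `hc` keeps the strength `ε / R` of the regularization below the smoothness of `Φ` at
`xs`, so it is bounded by the same quantities as the rest of the parameter. -/
theorem smoothParam_regularize_le {ε R ε' ℓ : ℝ} (hε : 0 < ε) (hR : 0 < R)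
    (hRB : √R ≤ ‖xs‖ + 1) (hε' : ε' / (ε / R) ≤ ‖xs‖ ^ 2)
    (hℓ : 1 ≤ ℓ) (hLx : Lx ≤ ℓ) (hLxy : Lxy ≤ ℓ) (hLy : Ly ≤ ℓ) (hLxy' : Lxy' ≤ ℓ) (hμℓ : μy ≤ ℓ)
    (hc : ε / R ≤ gradLipConst Lx Lxy Ly Lxy' ρxy ρyy μy ‖gradY f xs (yStar g xs)‖) :
    smoothParam (regularize f (ε / R)) g (Lx + ε / R) Lxy Ly Lxy' ρxy ρyy μy (ε / R) ε' ≤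
      49 * ℓ ^ 4 * (1 / μy ^ 2 + (ρyy / μy ^ 3 + ρxy / μy ^ 2) * deltaCSC f g xs μy ε) := by
  have hμ := h.μy_pos
  have hρxy := h.ρxy_nonneg
  have hρyy := h.ρyy_nonneg
  have hr := h.iterateRadius_regularize_le hxs hε hR hRB hε'
  have h2 := h.norm_argmin_regularize_le hxs (show 0 < ε / R by positivity)
  obtain ⟨h1, h3⟩ := h.deltaCSC_bounds hxs (ε := ε)
  rw [smoothParam_eq, gradY_regularize]
  set xt := argminPt (bilevelObj (regularize f (ε / R)) g)
  set D := iterateRadius (bilevelObj (regularize f (ε / R)) g) xt (ε / R) ε'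
  set Δ := deltaCSC f g xs μy ε
  have hΔ : 0 ≤ Δ := (norm_nonneg _).trans h1
  have hLxy'0 := h.Lxy'_nonneg
  have hLxy0 := h.Lxy_nonneg
  have hLy0 := h.Ly_nonneg
  have hD0 : 0 ≤ D := Real.sqrt_nonneg _
  have ha0 : 0 ≤ Lxy + Ly * Lxy' / μy := by positivity
  set b := ‖gradY f xt (yStar g xt)‖ + (Lxy + Ly * Lxy' / μy) * (3 * D) with hb
  have hb0 : 0 ≤ b := by positivity
  have hbΔ : b ≤ 17 * ℓ ^ 2 * Δ := by
    have h4 := h.norm_gradY_yStar_le xt xs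
    have h5 : ‖xt - xs‖ ≤ 2 * (μy * Δ) := (norm_sub_le _ _).trans (by linarith)
    have h6 : (Lxy + Ly * Lxy' / μy) * (‖xt - xs‖ + 3 * D) ≤ (ℓ + ℓ * ℓ / μy) * (8 * (μy * Δ)) := by
      have : ‖xt - xs‖ + 3 * D ≤ 8 * (μy * Δ) := by linarith
      gcongr
    have h7 : (ℓ + ℓ * ℓ / μy) * (8 * (μy * Δ)) = 8 * (ℓ * μy * Δ + ℓ * ℓ * Δ) := by
      field_simp
    have h8 : ℓ * μy * Δ ≤ ℓ * ℓ * Δ := by gcongr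
    have h9 : Δ ≤ ℓ * ℓ * Δ := le_mul_of_one_le_left hΔ (by nlinarith)
    linarith
  have hG := gradLipConst_le hℓ hLx hLxy hLy hLxy' hμℓ hLxy'0 hρxy hρyy hμ hb0
  have hG0 := gradLipConst_le hℓ hLx hLxy hLy hLxy' hμℓ hLxy'0 hρxy hρyy hμ
    (norm_nonneg (gradY f xs (yStar g xs)))
  have e : gradLipConst (Lx + ε / R) Lxy Ly Lxy' ρxy ρyy μy b
      = ε / R + gradLipConst Lx Lxy Ly Lxy' ρxy ρyy μy b := by
    simp only [gradLipConst]; ring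
  rw [e]
  set r := ρyy / μy ^ 3 + ρxy / μy ^ 2
  have hr0 : 0 ≤ r := by positivity
  have hℓ34 : ℓ ^ 3 ≤ ℓ ^ 4 := pow_le_pow_right₀ hℓ (by norm_num)
  have hℓ24 : ℓ ^ 2 ≤ ℓ ^ 4 := pow_le_pow_right₀ hℓ (by norm_num)
  have h10 : 2 * ℓ ^ 2 * r * ‖gradY f xs (yStar g xs)‖ ≤ 2 * ℓ ^ 4 * r * Δ := by gcongr
  have h11 : 2 * ℓ ^ 2 * r * b ≤ 2 * ℓ ^ 2 * r * (17 * ℓ ^ 2 * Δ) := by gcongr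
  have h12 : ℓ ^ 3 * (1 / μy ^ 2) ≤ ℓ ^ 4 * (1 / μy ^ 2) := by gcongr
  have h13 : 0 ≤ ℓ ^ 4 * (1 / μy ^ 2) := by positivity
  have h14 : 0 ≤ ℓ ^ 4 * r * Δ := by positivity
  linarith

set_option maxHeartbeats 800000 in
/-- The complexity of AccBiO for the regularized problem, up to accuracy `ε'`. -/
theorem regularized_complexity [Nontrivial F] {ε R ε' ℓ τ L : ℝ} (hε : 0 < ε) (hR : 0 < R)
    (hRB : √R ≤ ‖xs‖ + 1) (hε'0 : 0 < ε') (hε' : ε' / (ε / R) ≤ ‖xs‖ ^ 2)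
    (hℓ : 1 ≤ ℓ) (hLx : Lx ≤ ℓ) (hLxy : Lxy ≤ ℓ) (hLy : Ly ≤ ℓ) (hLxy' : Lxy' ≤ ℓ) (hμℓ : μy ≤ ℓ)
    (hτ : 0 ≤ τ)
    (hc : ε / R ≤ gradLipConst Lx Lxy Ly Lxy' ρxy ρyy μy ‖gradY f xs (yStar g xs)‖)
    (hL : L = smoothParam (regularize f (ε / R)) g (Lx + ε / R) Lxy Ly Lxy' ρxy ρyy μy
      (ε / R) ε')
    (hεL : 1 / ε' ≤ 12 * L * (1 / ε) ^ 2 + 2 * (1 / ε)) :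
    ∃ K N M : ℕ,
      ‖(accBiO (regularize f (ε / R)) g Ly' μy L (ε / R) N M K).val.1
          - argminPt (bilevelObj (regularize f (ε / R)) g)‖ ≤
        iterateRadius (bilevelObj (regularize f (ε / R)) g)
          (argminPt (bilevelObj (regularize f (ε / R)) g)) (ε / R) ε' ∧
      bilevelObj (regularize f (ε / R)) g
          (accBiO (regularize f (ε / R)) g Ly' μy L (ε / R) N M K).val.1
        - bilevelObj (regularize f (ε / R)) g
          (argminPt (bilevelObj (regularize f (ε / R)) g)) ≤ ε' ∧
      (accBiO (regularize f (ε / R)) g Ly' μy L (ε / R) N M K).cost.total τ ≤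
        (τ + 1) * 1000000 * ℓ ^ 2 * (1 + Real.log ℓ / Real.log 2) ^ 2
          * (√(R * Ly' / (ε * μy ^ 3))
            + (√(R * ρyy * Ly' / (ε * μy ^ 4)) + √(R * ρxy * Ly' / (ε * μy ^ 3)))
              * √(deltaCSC f g xs μy ε))
          * Real.log (logArg f g xs Ly' ρxy ρyy μy ε) ^ 2 := by
  have hμ := h.μy_pos
  have hρxy := h.ρxy_nonneg
  have hρyy := h.ρyy_nonneg
  have hLxy'0 := h.Lxy'_nonneg
  have hLxy0 := h.Lxy_nonneg
  have hLy0 := h.Ly_nonneg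
  have hLy'0 := h.Ly'_nonneg
  have hc0 : 0 < ε / R := by positivity
  have hreg := h.add_regularization hc0.le
  have hsc := h.strongConvexOn_regularize (ε / R)
  have hLle := h.smoothParam_regularize_le hxs hε hR hRB hε' hℓ hLx hLxy hLy hLxy' hμℓ hc
  have hrad := h.iterateRadius_regularize_le hxs hε hR hRB hε'
  have hball := fun x hx => h.norm_sub_le_of_mem_ball hxs hε hR hRB hε' (x := x) hx
  have hmin := hreg.argmin_bilevelObj_le hsc hc0
  obtain ⟨hbΔ, hBΔ⟩ := h.deltaCSC_bounds hxs (ε := ε)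
  rw [← hL] at hLle
  have hcL : ε / R ≤ L := by
    rw [hL, smoothParam_eq, gradLipConst]
    have h1 : 0 ≤ iterateRadius (bilevelObj (regularize f (ε / R)) g)
      (argminPt (bilevelObj (regularize f (ε / R)) g)) (ε / R) ε' := Real.sqrt_nonneg _
    have h2 := h.Lx_nonneg
    have h3 : ∀ b : ℝ, 0 ≤ b → ε / R ≤ Lx + ε / R + 2 * Lxy * Lxy' / μy + Ly * Lxy' ^ 2 / μy ^ 2
        + (Lxy' * ρyy / μy ^ 2 + ρxy / μy) * (1 + Lxy' / μy) * b := by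
      intro b hb
      have h4 : 0 ≤ Lx + 2 * Lxy * Lxy' / μy + Ly * Lxy' ^ 2 / μy ^ 2
        + (Lxy' * ρyy / μy ^ 2 + ρxy / μy) * (1 + Lxy' / μy) * b := by positivity
      linarith
    exact h3 _ (by positivity)
  have hL0 : 0 < L := hc0.trans_le hcL
  set Δ := deltaCSC f g xs μy ε with hΔdef
  have hΔ : 0 ≤ Δ := (norm_nonneg _).trans hbΔ
  set P := logArg f g xs Ly' ρxy ρyy μy ε with hP
  have hε1 : 0 < 1 / ε := by positivity
  have hμ1 : 0 < 1 / μy := by positivity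
  have hy0 := norm_nonneg (yStar g xs)
  have hPeq : P = 2 + 1 / ε + 1 / μy + Δ + ‖yStar g xs‖ + Ly' + ρxy + ρyy := rfl
  have hP2 : 2 ≤ P := by linarith
  have hPQ : P ≤ ℓ * P := le_mul_of_one_le_left (by linarith) hℓ
  have hQ : 2 ≤ ℓ * P := by linarith
  have hℓQ : ℓ ≤ ℓ * P := le_mul_of_one_le_right (by linarith) (by linarith)
  -- Every primitive quantity lies below this `Q`, so composite ones are below explicit powers of
  -- it. The exponents are far from sharp and only affect the constant.
  set Q := ℓ * P with hQdef
  have one : ∀ a : ℝ, 0 ≤ a → a ≤ Q → IsPowBounded Q 1 a := fun a ha haQ => ⟨ha, by simpa using haQ⟩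
  have nonneg_mono : ∀ {n : ℕ} {a b : ℝ}, IsPowBounded Q n b → 0 ≤ a → a ≤ b → IsPowBounded Q n a :=
    fun hb ha hab => ⟨ha, hab.trans hb.2⟩
  have bℓ : IsPowBounded Q 1 ℓ := one _ (by linarith) hℓQ
  have bΔ : IsPowBounded Q 1 Δ := one _ hΔ (by linarith)
  have bμ : IsPowBounded Q 1 μy := one _ hμ.le (by linarith)
  have bμi : IsPowBounded Q 1 (1 / μy) := one _ hμ1.le (by linarith)
  have bεi : IsPowBounded Q 1 (1 / ε) := one _ hε1.le (by linarith)
  have bLxy : IsPowBounded Q 1 Lxy := one _ hLxy0 (by linarith)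
  have bLy : IsPowBounded Q 1 Ly := one _ hLy0 (by linarith)
  have bLxy' : IsPowBounded Q 1 Lxy' := one _ hLxy'0 (by linarith)
  have bLy' : IsPowBounded Q 1 Ly' := one _ hLy'0 (by linarith)
  have bρxy : IsPowBounded Q 1 ρxy := one _ hρxy (by linarith)
  have bρyy : IsPowBounded Q 1 ρyy := one _ hρyy (by linarith)
  have by0 : IsPowBounded Q 1 ‖yStar g xs‖ := one _ hy0 (by linarith)
  have b1 : IsPowBounded Q 0 (1 : ℝ) := .of_le_two_pow (by norm_num) hQ (by norm_num)
  have b2 : IsPowBounded Q 1 (2 : ℝ) := .of_le_two_pow (by norm_num) hQ (by norm_num)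
  have b4 : IsPowBounded Q 2 (4 : ℝ) := .of_le_two_pow (by norm_num) hQ (by norm_num)
  have b8 : IsPowBounded Q 3 (8 : ℝ) := .of_le_two_pow (by norm_num) hQ (by norm_num)
  have b12 : IsPowBounded Q 4 (12 : ℝ) := .of_le_two_pow (by norm_num) hQ (by norm_num)
  have b17 : IsPowBounded Q 5 (17 : ℝ) := .of_le_two_pow (by norm_num) hQ (by norm_num)
  have b49 : IsPowBounded Q 6 (49 : ℝ) := .of_le_two_pow (by norm_num) hQ (by norm_num)
  have bμi2 : IsPowBounded Q 2 (1 / μy ^ 2) := by rw [← one_div_pow]; exact bμi.pow 2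
  have bμi3 : IsPowBounded Q 3 (1 / μy ^ 3) := by rw [← one_div_pow]; exact bμi.pow 3
  have bB : IsPowBounded Q 2 ‖xs‖ := nonneg_mono (bμ.mul bΔ) (norm_nonneg _) hBΔ
  have bR : IsPowBounded Q 6 R := by
    refine nonneg_mono ((bB.add b1 hQ).pow 2) hR.le ?_
    rw [← Real.sq_sqrt hR.le]
    exact pow_le_pow_left₀ (Real.sqrt_nonneg _) hRB 2
  have bL : IsPowBounded Q 18 L := nonneg_mono
    (((b49.mul (bℓ.pow 4)).mul (bμi2.add (((bρyy.div bμi3).add (bρxy.div bμi2) hQ).mul bΔ)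
      hQ)).mono hQ (by norm_num)) hL0.le hLle
  have bc : IsPowBounded Q 18 (ε / R) := nonneg_mono bL hc0.le hcL
  have bκ : IsPowBounded Q 25 √(L / (ε / R)) := by
    refine IsPowBounded.sqrt ?_ hQ
    rw [div_div_eq_mul_div, mul_div_assoc]
    exact (bL.mul (bR.div bεi)).mono hQ (by norm_num)
  have bs : IsPowBounded Q 2 √(Ly' / μy) := (bLy'.div bμi).sqrt hQ
  set D := iterateRadius (bilevelObj (regularize f (ε / R)) g)
          (argminPt (bilevelObj (regularize f (ε / R)) g)) (ε / R) ε' with hD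
  have bD : IsPowBounded Q 3 D := nonneg_mono (b2.mul (bμ.mul bΔ)) (Real.sqrt_nonneg _) hrad
  have bb : IsPowBounded Q 8 (17 * ℓ ^ 2 * Δ) := (b17.mul (bℓ.pow 2)).mul bΔ
  have bY : IsPowBounded Q 6 (‖yStar g xs‖ + 8 * (Lxy' * Δ)) := by0.add (b8.mul (bLxy'.mul bΔ)) hQ
  have bεi' : IsPowBounded Q 26 (1 / ε') := nonneg_mono
    ((((b12.mul bL).mul (bεi.pow 2)).add (b2.mul bεi) hQ).mono hQ (by norm_num))
    (by positivity) hεL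
  have hε'Q : 1 ≤ ε' * Q ^ 26 := by
    have h1 := mul_le_mul_of_nonneg_left bεi'.2 hε'0.le
    rwa [mul_one_div_cancel hε'0.ne'] at h1
  -- The exponent `200 = 174 + 26` leaves `Q ^ 26` to compensate for the possibly small target
  -- accuracy `ε'`.
  have hreduce : ∀ {a : ℝ} {n : ℕ}, IsPowBounded Q n a → n ≤ 174 → a ≤ ε' * Q ^ 200 := by
    intro a n ha hn
    have h1 : 0 ≤ Q ^ 174 := by positivity
    calc a ≤ 1 * Q ^ 174 := by rw [one_mul]; exact (ha.mono hQ hn).2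
      _ ≤ ε' * Q ^ 26 * Q ^ 174 := mul_le_mul_of_nonneg_right hε'Q h1
      _ = ε' * Q ^ 200 := by rw [mul_assoc, ← pow_add]
  have hgap := hmin 0
  have hE := ((b4.mul ((((bLxy.add ((bLxy'.div bμi).mul bLy) hQ).add
      ((((bLxy'.mul bρyy).div bμi2).add (bρxy.div bμi) hQ).mul bb) hQ).mul
        ((b2.mul bs).mul bY)).add (bLxy'.mul ((b4.mul (bs.add b1 hQ)).mul
          ((bb.add (bLy.mul ((b2.mul bs).mul bY)) hQ).div bμi))) hQ)).mul bD).mul bκ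
  obtain ⟨K, N, M, h1, h2, h3⟩ := hreg.accBiO_complexity (Q := Q) (b := 17 * ℓ ^ 2 * Δ)
    (Y := ‖yStar g xs‖ + 8 * (Lxy' * Δ)) 200 hsc hc0 hε'0 hτ hL hcL hQ
    (fun x hx => by
      rw [gradY_regularize]
      exact h.norm_gradY_le_of_norm_sub_le hxs hℓ hLxy hLy hLxy' hμℓ (hball x hx))
    (fun x hx => by
      have h1 := h.yStar_lipschitz x xs
      have h2 : ‖yStar g x‖ ≤ ‖yStar g xs‖ + ‖yStar g x - yStar g xs‖ := by
        have e : yStar g x = yStar g xs + (yStar g x - yStar g xs) := by abel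
        exact (congrArg norm e).trans_le (norm_add_le _ _)
      have h3 : Lxy' / μy * ‖x - xs‖ ≤ Lxy' / μy * (8 * (μy * Δ)) :=
        mul_le_mul_of_nonneg_left (hball x hx) (by positivity)
      have h4 : Lxy' / μy * (8 * (μy * Δ)) = 8 * (Lxy' * Δ) := by field_simp
      linarith)
    (hreduce hE (by norm_num))
    (by
      refine le_trans ?_ (hreduce (bc.mul (bD.pow 2)) (by norm_num))
      -- Twice the initial energy is at most `(ε / R) * D²`, by the definition of the radius, so its
      -- polynomial bound comes from that of `D`.
      have e : ε / R * D ^ 2 = 2 * (bilevelObj (regularize f (ε / R)) g 0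
          - bilevelObj (regularize f (ε / R)) g
            (argminPt (bilevelObj (regularize f (ε / R)) g)))
          + ε / R * ‖argminPt (bilevelObj (regularize f (ε / R)) g)‖ ^ 2 + ε' := by
        have h0 := sub_nonneg.2 hgap
        rw [hD, iterateRadius, Real.sq_sqrt (by positivity)]
        field_simp
      rw [e]; linarith)
  refine ⟨K, N, M, h1, h2, h3.trans ?_⟩
  have hcond := sqrt_cond_mul_le (Ly' := Ly') hε hR hμ hρyy hρxy hLy'0 hΔ hL0 hLle
  have hlogQ := log_mul_le_mul_log hℓ hP2
  have hlogQ0 : 0 ≤ Real.log Q := Real.log_nonneg (by linarith)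
  set W := √(R * Ly' / (ε * μy ^ 3)) + (√(R * ρyy * Ly' / (ε * μy ^ 4))
    + √(R * ρxy * Ly' / (ε * μy ^ 3))) * √Δ
  have hlogP : 0 ≤ Real.log P := Real.log_nonneg (by linarith)
  have hlogℓ : 0 ≤ Real.log ℓ / Real.log 2 :=
    div_nonneg (Real.log_nonneg hℓ) (Real.log_nonneg (by norm_num))
  have hW0 : 0 ≤ W := by positivity
  have hτ1 : 0 ≤ τ + 1 := by linarith
  calc (τ + 1) * ((200 : ℕ) + 2) * (2 * (200 : ℕ) + 6) * (√(L / (ε / R)) * √(Ly' / μy))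
        * Real.log Q ^ 2
      ≤ (τ + 1) * ((200 : ℕ) + 2) * (2 * (200 : ℕ) + 6) * (7 * ℓ ^ 2 * W)
        * ((1 + Real.log ℓ / Real.log 2) * Real.log P) ^ 2 := by gcongr
    _ = (τ + 1) * 574084 * (ℓ ^ 2 * (1 + Real.log ℓ / Real.log 2) ^ 2 * W * Real.log P ^ 2) := by
      push_cast; ring
    _ ≤ (τ + 1) * 1000000 * (ℓ ^ 2 * (1 + Real.log ℓ / Real.log 2) ^ 2 * W * Real.log P ^ 2) := by
      gcongr; norm_num
    _ = _ := by ring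

end IsConvexStronglyConvex

/-! ### The implicit choice of `L` and the two conclusions. -/

/-- Intermediate value theorem for `t - φ t` on `[0, φ 0]`; the root is not `0` because `φ 0 > 0`.
-/
theorem exists_pos_eq_of_antitone {φ : ℝ → ℝ} (h0 : 0 < φ 0) (hφ : ContinuousOn φ (Ici 0))
    (hanti : AntitoneOn φ (Ici 0)) : ∃ L, 0 < L ∧ L = φ L := by
  have hc : ContinuousOn (fun t => t - φ t) (Icc 0 (φ 0)) :=
    continuousOn_id.sub (hφ.mono Icc_subset_Ici_self)
  have hmem : (0 : ℝ) ∈ Icc ((fun t => t - φ t) 0) ((fun t => t - φ t) (φ 0)) := by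
    have := hanti (mem_Ici.2 le_rfl) (mem_Ici.2 h0.le) h0.le
    constructor <;> simp only [] <;> linarith
  obtain ⟨L, hL, hLeq⟩ := intermediate_value_Icc h0.le hc hmem
  simp only [] at hLeq
  refine ⟨L, lt_of_le_of_ne hL.1 fun h => ?_, by linarith⟩
  rw [← h] at hLeq
  linarith

namespace IsConvexStronglyConvex

variable {E F : Type*}
  [NormedAddCommGroup E] [InnerProductSpace ℝ E] [CompleteSpace E] [FiniteDimensional ℝ E]
  [NormedAddCommGroup F] [InnerProductSpace ℝ F] [CompleteSpace F] [FiniteDimensional ℝ F]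
  {f g : E → F → ℝ} {Lx Lxy Ly Lxy' Ly' ρxy ρyy μy : ℝ}
  (h : IsConvexStronglyConvex f g Lx Lxy Ly Lxy' Ly' ρxy ρyy μy)

include h

/-- A larger `L` demands a smaller target accuracy, and `smoothParam` is monotone in that accuracy;
the composite is antitone, so the circular definition of `L` has a solution. -/
theorem exists_eq_smoothParam {μx ε : ℝ} (hμx : 0 < μx) (hε : 0 < ε) (hLx : 0 < Lx) :
    ∃ L, 0 < L ∧
      L = smoothParam f g Lx Lxy Ly Lxy' ρxy ρyy μy μx (ε ^ 2 / (4 * L + 8 * μx)) := by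
  have hμ := h.μy_pos
  have hρxy := h.ρxy_nonneg
  have hρyy := h.ρyy_nonneg
  have hLxy'0 := h.Lxy'_nonneg
  have hLxy0 := h.Lxy_nonneg
  have hLy0 := h.Ly_nonneg
  have hcont : Continuous (smoothParam f g Lx Lxy Ly Lxy' ρxy ρyy μy μx) := by
    unfold smoothParam; fun_prop
  have hmono : Monotone (smoothParam f g Lx Lxy Ly Lxy' ρxy ρyy μy μx) := by
    intro a b hab
    simp only [smoothParam]
    gcongr
  refine exists_pos_eq_of_antitone
    (φ := fun L => smoothParam f g Lx Lxy Ly Lxy' ρxy ρyy μy μx (ε ^ 2 / (4 * L + 8 * μx)))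
    ?_ ?_ ?_
  · simp only [smoothParam]
    positivity
  · refine hcont.comp_continuousOn (continuousOn_const.div (by fun_prop) fun t ht => ?_)
    have : (0 : ℝ) ≤ t := ht
    positivity
  · intro a ha b hb hab
    have ha : (0 : ℝ) ≤ a := ha
    refine hmono ?_
    gcongr

variable {xs : E} (hxs : ∀ x, bilevelObj f g xs ≤ bilevelObj f g x)

include hxs

theorem norm_exactHypergrad_le (x : E) :
    ‖exactHypergrad f g x (yStar g x)‖ ≤
      gradLipConst Lx Lxy Ly Lxy' ρxy ρyy μy ‖gradY f xs (yStar g xs)‖ * ‖x - xs‖ := by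
  have h1 := h.gradient_lipschitz_at le_rfl (c := xs) x
  rwa [(h.hasGradientAt_bilevelObj xs).eq_zero_of_forall_le hxs, sub_zero] at h1

theorem bilevelObj_sub_le (x : E) :
    bilevelObj f g x - bilevelObj f g xs ≤
      gradLipConst Lx Lxy Ly Lxy' ρxy ρyy μy ‖gradY f xs (yStar g xs)‖ / 2 * ‖x - xs‖ ^ 2 := by
  have h1 := le_add_inner_add_of_gradient_lipschitz_at h.hasGradientAt_bilevelObj
    (h.gradient_lipschitz_at le_rfl (c := xs)) x
  rw [(h.hasGradientAt_bilevelObj xs).eq_zero_of_forall_le hxs, inner_zero_left] at h1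
  rw [gradLipConst]
  linarith

theorem suboptimality_complexity [Nontrivial F] {ε ℓ τ B : ℝ} (hε : 0 < ε) (hB : ‖xs‖ = B)
    (hB0 : 0 < B) (hℓ : 1 ≤ ℓ) (hLx : Lx ≤ ℓ) (hLxy : Lxy ≤ ℓ) (hLy : Ly ≤ ℓ) (hLxy' : Lxy' ≤ ℓ)
    (hμℓ : μy ≤ ℓ) (hτ : 0 ≤ τ) :
    ∃ L : ℝ,
      L = smoothParam (regularize f (ε / B ^ 2)) g (Lx + ε / B ^ 2) Lxy Ly Lxy' ρxy ρyy μy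
        (ε / B ^ 2) (ε / 2) ∧
      ∃ K N M : ℕ,
        bilevelObj f g
            (accBiO (regularize f (ε / B ^ 2)) g Ly' μy L (ε / B ^ 2) N M K).val.1
          - bilevelObj f g xs ≤ ε ∧
        (accBiO (regularize f (ε / B ^ 2)) g Ly' μy L (ε / B ^ 2) N M K).cost.total τ ≤
          ((τ + 1) * 1000000 * ℓ ^ 2 * (1 + Real.log ℓ / Real.log 2) ^ 2)
            * (B * (√(Ly' / (ε * μy ^ 3))
            + (√(ρyy * Ly' / (ε * μy ^ 4)) + √(ρxy * Ly' / (ε * μy ^ 3)))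
              * √(deltaCSC f g xs μy ε)))
            * Real.log (logArg f g xs Ly' ρxy ρyy μy ε) ^ 2 := by
  refine ⟨_, rfl, ?_⟩
  set L := smoothParam (regularize f (ε / B ^ 2)) g (Lx + ε / B ^ 2) Lxy Ly Lxy' ρxy ρyy μy
    (ε / B ^ 2) (ε / 2) with hL
  by_cases htriv : bilevelObj f g 0 - bilevelObj f g xs ≤ ε
  -- The starting point already meets the target; nothing is computed.
  · refine ⟨0, 0, 0, htriv, ?_⟩
    rw [accBiO_cost, OracleCost.total]
    simp only [Nat.cast_zero, zero_mul, add_zero, mul_zero]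
    positivity
  · have hR : 0 < B ^ 2 := by positivity
    -- The gap at the origin exceeds `ε`, while smoothness at `xs` bounds it by half the local
    -- constant times `B²`.
    have hc : ε / B ^ 2 ≤
        gradLipConst Lx Lxy Ly Lxy' ρxy ρyy μy ‖gradY f xs (yStar g xs)‖ := by
      have h1 := h.bilevelObj_sub_le hxs 0
      rw [zero_sub, norm_neg, hB] at h1
      rw [div_le_iff₀ hR]
      linarith
    have hc0 : 0 < ε / B ^ 2 := by positivity
    have hε1 : 0 < 1 / ε := by positivity
    have hLnn : 0 ≤ L := by
      have := h.μy_pos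
      have := h.ρxy_nonneg
      have := h.ρyy_nonneg
      have := h.Lxy'_nonneg
      have := h.Lxy_nonneg
      have := h.Ly_nonneg
      have := h.Lx_nonneg
      simp only [hL, smoothParam]
      positivity
    obtain ⟨K, N, M, -, h2, h3⟩ := h.regularized_complexity hxs hε hR
      (by rw [Real.sqrt_sq hB0.le, hB]; linarith) (half_pos hε)
      (by
        have e : ε / 2 / (ε / B ^ 2) = B ^ 2 / 2 := by field_simp
        rw [e, hB]; linarith)
      hℓ hLx hLxy hLy hLxy' hμℓ hτ hc hL
      (by
        have e : 1 / (ε / 2) = 2 * (1 / ε) := by field_simp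
        rw [e]
        have : 0 ≤ 12 * L * (1 / ε) ^ 2 := by positivity
        linarith)
    refine ⟨K, N, M, ?_, h3.trans (le_of_eq ?_)⟩
    -- Half of `ε` is the optimization error; the other half is the regularization term at `xs`,
    -- which equals `ε / 2` as `R = B²`.
    · have h4 := (h.add_regularization hc0.le).argmin_bilevelObj_le (h.strongConvexOn_regularize _) hc0 xs
      set z := (accBiO (regularize f (ε / B ^ 2)) g Ly' μy L (ε / B ^ 2) N M K).val.1
      have h5 : bilevelObj (regularize f (ε / B ^ 2)) g z
          = bilevelObj f g z + ε / B ^ 2 / 2 * ‖z‖ ^ 2 := rfl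
      have h6 : bilevelObj (regularize f (ε / B ^ 2)) g xs
          = bilevelObj f g xs + ε / B ^ 2 / 2 * ‖xs‖ ^ 2 := rfl
      have h7 : ε / B ^ 2 / 2 * ‖xs‖ ^ 2 = ε / 2 := by rw [hB]; field_simp
      have h8 : 0 ≤ ε / B ^ 2 / 2 * ‖z‖ ^ 2 := by positivity
      linarith
    · have hpull : ∀ a b : ℝ, √(B ^ 2 * a / b) = B * √(a / b) := by
        intro a b
        rw [mul_div_assoc, Real.sqrt_mul (by positivity), Real.sqrt_sq hB0.le]
      rw [mul_assoc (B ^ 2) ρyy, mul_assoc (B ^ 2) ρxy, hpull, hpull, hpull]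
      ring

theorem gradient_complexity [Nontrivial F] {ε ℓ τ B : ℝ} (hε : 0 < ε) (hB : ‖xs‖ = B)
    (hB0 : 0 < B) (hℓ : 1 ≤ ℓ) (hLx : Lx ≤ ℓ) (hLxy : Lxy ≤ ℓ) (hLy : Ly ≤ ℓ) (hLxy' : Lxy' ≤ ℓ)
    (hμℓ : μy ≤ ℓ) (hτ : 0 ≤ τ) :
    ∃ L : ℝ, 0 < L ∧
      L = smoothParam (regularize f (ε / B)) g (Lx + ε / B) Lxy Ly Lxy' ρxy ρyy μy
        (ε / B) (ε ^ 2 / (4 * L + 8 * ε / B)) ∧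
      ∃ K N M : ℕ,
        ‖gradient (bilevelObj f g)
            (accBiO (regularize f (ε / B)) g Ly' μy L (ε / B) N M K).val.1‖ ≤ 5 * ε ∧
        (accBiO (regularize f (ε / B)) g Ly' μy L (ε / B) N M K).cost.total τ ≤
          ((τ + 1) * 1000000 * ℓ ^ 2 * (1 + Real.log ℓ / Real.log 2) ^ 2)
            * (√(B * Ly' / (ε * μy ^ 3))
            + (√(B * ρyy * Ly' / (ε * μy ^ 4)) + √(B * ρxy * Ly' / (ε * μy ^ 3)))
              * √(deltaCSC f g xs μy ε))
            * Real.log (logArg f g xs Ly' ρxy ρyy μy ε) ^ 2 := by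
  have hc0 : 0 < ε / B := by positivity
  have hreg := h.add_regularization hc0.le
  have hgrad : ∀ x, gradient (bilevelObj f g) x = exactHypergrad f g x (yStar g x) :=
    fun x => (h.hasGradientAt_bilevelObj x).gradient
  simp only [mul_div_assoc 8 ε B, hgrad]
  obtain ⟨L, hL0, hL⟩ := hreg.exists_eq_smoothParam hc0 hε (by linarith [h.Lx_nonneg])
  refine ⟨L, hL0, hL, ?_⟩
  by_cases htriv : ‖exactHypergrad f g 0 (yStar g 0)‖ ≤ 5 * ε
  · refine ⟨0, 0, 0, htriv, ?_⟩
    rw [accBiO_cost, OracleCost.total]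
    simp only [Nat.cast_zero, zero_mul, add_zero, mul_zero]
    positivity
  -- The gradient at the origin exceeds `5 * ε` and is at most the local constant times `B`.
  · have hc : ε / B ≤ gradLipConst Lx Lxy Ly Lxy' ρxy ρyy μy ‖gradY f xs (yStar g xs)‖ := by
      have h1 := h.norm_exactHypergrad_le hxs 0
      rw [zero_sub, norm_neg, hB] at h1
      rw [div_le_iff₀ hB0]
      linarith
    have hcL : ε / B ≤ L := by
      have := h.μy_pos
      have := h.ρxy_nonneg
      have := h.ρyy_nonneg
      have := h.Lxy'_nonneg
      have := h.Lxy_nonneg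
      have := h.Ly_nonneg
      have h2 := h.Lx_nonneg
      rw [hL]
      simp only [smoothParam]
      simp only [add_assoc, add_left_comm Lx (ε / B)]
      refine le_add_of_nonneg_right ?_
      positivity
    set e := ε ^ 2 / (4 * L + 8 * (ε / B)) with he
    have he0 : 0 < e := by positivity
    obtain ⟨K, N, M, h1, h2, h3⟩ := h.regularized_complexity hxs hε hB0
      (by
        rw [hB, Real.sqrt_le_left (by linarith)]
        nlinarith) he0
      (by
        rw [he, hB, div_div, div_le_iff₀ (by positivity)]
        have e1 : B ^ 2 * ((4 * L + 8 * (ε / B)) * (ε / B)) = 4 * L * ε * B + 8 * ε ^ 2 := by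
          field_simp
        rw [e1]
        have : 0 ≤ 4 * L * ε * B := by positivity
        nlinarith [sq_nonneg ε])
      hℓ hLx hLxy hLy hLxy' hμℓ hτ hc hL
      (by
        rw [he, one_div_div, div_eq_mul_inv, one_div, inv_pow]
        have h4 : 0 < (ε ^ 2)⁻¹ := by positivity
        have h5 : 0 < ε⁻¹ := by positivity
        -- As `ε / B ≤ L`, the denominator of the target accuracy is at most `12 * L`.
        have h6 : (4 * L + 8 * (ε / B)) * (ε ^ 2)⁻¹ ≤ 12 * L * (ε ^ 2)⁻¹ :=
          mul_le_mul_of_nonneg_right (by linarith) h4.le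
        linarith)
    refine ⟨K, N, M, ?_, h3⟩
    have hsc := h.strongConvexOn_regularize (ε / B)
    have hmin := hreg.argmin_bilevelObj_le hsc hc0
    have hxt := h.norm_argmin_regularize_le hxs hc0
    have hquad := hsc.sq_dist_le_of_forall_le (hreg.hasGradientAt_bilevelObj _) hmin
      (accBiO (regularize f (ε / B)) g Ly' μy L (ε / B) N M K).val.1
    have hlip := hreg.gradient_lipschitz_smoothParam (μx := ε / B) (ε := e)
      (h1.trans (by
        rw [← one_mul (iterateRadius _ _ _ _), ← mul_assoc]
        exact mul_le_mul_of_nonneg_right (by norm_num) (Real.sqrt_nonneg _)))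
    rw [← hL] at hlip
    have hsq := sq_norm_gradient_le hL0 hreg.hasGradientAt_bilevelObj hlip hmin
    rw [h.exactHypergrad_regularize] at hsq
    set z := (accBiO (regularize f (ε / B)) g Ly' μy L (ε / B) N M K).val.1
    set xt := argminPt (bilevelObj (regularize f (ε / B)) g)
    -- This choice of accuracy serves two estimates: `2 L e ≤ ε²` bounds the regularized gradient by
    -- `ε`, and `2 (ε/B) e ≤ ε²` bounds `(ε/B) ‖z - xt‖` by `ε`. Together with `(ε/B) ‖xt‖ ≤ ε`,
    -- they give `3 * ε` in total.
    have he4 : (4 * L + 8 * (ε / B)) * e = ε ^ 2 := by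
      rw [he]; field_simp
    have h4 : ‖exactHypergrad f g z (yStar g z) + (ε / B) • z‖ ≤ ε := by
      refine le_of_sq_le_sq ?_ hε.le
      have h5 := mul_le_mul_of_nonneg_left h2 (show 0 ≤ 2 * L by positivity)
      have h6 : 0 ≤ ε / B * e := by positivity
      have h7 : 0 ≤ L * e := by positivity
      linarith
    have h5 : ε / B * ‖z - xt‖ ≤ ε := by
      refine le_of_sq_le_sq ?_ hε.le
      have h6 : (ε / B * ‖z - xt‖) ^ 2 = 2 * (ε / B) * (ε / B / 2 * ‖z - xt‖ ^ 2) := by ring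
      have h7 := mul_le_mul_of_nonneg_left (hquad.trans h2) (show 0 ≤ 2 * (ε / B) by positivity)
      have h8 : 0 ≤ ε / B * e := by positivity
      have h9 : 0 ≤ L * e := by positivity
      rw [h6]
      linarith
    have h6 : ε / B * ‖z‖ ≤ 2 * ε := by
      have h7 : ‖z‖ ≤ ‖z - xt‖ + B := by
        have e1 : z = (z - xt) + xt := by abel
        calc ‖z‖ = ‖(z - xt) + xt‖ := by rw [← e1]
          _ ≤ ‖z - xt‖ + ‖xt‖ := norm_add_le _ _
          _ ≤ _ := by rw [← hB]; linarith
      have h8 := mul_le_mul_of_nonneg_left h7 hc0.le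
      have h9 : ε / B * B = ε := by field_simp
      linarith
    have h7 : exactHypergrad f g z (yStar g z)
        = (exactHypergrad f g z (yStar g z) + (ε / B) • z) - (ε / B) • z := by abel
    rw [h7]
    refine (norm_sub_le _ _).trans ?_
    rw [norm_smul, Real.norm_of_nonneg hc0.le]
    linarith

end IsConvexStronglyConvex

theorem theorem4 (ℓ τ : ℝ) (hτ : 0 < τ) :
    ∃ C : ℝ, 0 < C ∧
      ∀ (p q : ℕ), 0 < q →
      ∀ (f g : EuclideanSpace ℝ (Fin p) → EuclideanSpace ℝ (Fin q) → ℝ)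
        (Lx Lxy Ly Lxy' Ly' ρxy ρyy μy : ℝ),
        IsConvexStronglyConvex f g Lx Lxy Ly Lxy' Ly' ρxy ρyy μy →
        Lx ≤ ℓ → Lxy ≤ ℓ → Ly ≤ ℓ → Lxy' ≤ ℓ → μy ≤ ℓ →
      ∀ (xs : EuclideanSpace ℝ (Fin p)) (B : ℝ),
        (∀ x, bilevelObj f g xs ≤ bilevelObj f g x) → ‖xs‖ = B → 0 < B →
      ∀ ε : ℝ, 0 < ε →
        -- suboptimality gap, with `R = B ^ 2`
        (∃ L : ℝ,
          L = smoothParam (regularize f (ε / B ^ 2)) g (Lx + ε / B ^ 2) Lxy Ly Lxy' ρxy ρyy μy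
            (ε / B ^ 2) (ε / 2) ∧
          ∃ K N M : ℕ,
            bilevelObj f g
                (accBiO (regularize f (ε / B ^ 2)) g Ly' μy L (ε / B ^ 2) N M K).val.1
              - bilevelObj f g xs ≤ ε ∧
            (accBiO (regularize f (ε / B ^ 2)) g Ly' μy L (ε / B ^ 2) N M K).cost.total τ ≤
              C * (B * (√(Ly' / (ε * μy ^ 3))
                + (√(ρyy * Ly' / (ε * μy ^ 4)) + √(ρxy * Ly' / (ε * μy ^ 3)))
                  * √(deltaCSC f g xs μy ε)))
                * Real.log (logArg f g xs Ly' ρxy ρyy μy ε) ^ 2) ∧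
        -- gradient norm, with `R = B`
        (Differentiable ℝ (bilevelObj f g) ∧
          ∃ L : ℝ, 0 < L ∧
          L = smoothParam (regularize f (ε / B)) g (Lx + ε / B) Lxy Ly Lxy' ρxy ρyy μy
            (ε / B) (ε ^ 2 / (4 * L + 8 * ε / B)) ∧
          ∃ K N M : ℕ,
            ‖gradient (bilevelObj f g)
                (accBiO (regularize f (ε / B)) g Ly' μy L (ε / B) N M K).val.1‖ ≤ 5 * ε ∧
            (accBiO (regularize f (ε / B)) g Ly' μy L (ε / B) N M K).cost.total τ ≤
              C * (√(B * Ly' / (ε * μy ^ 3))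
                + (√(B * ρyy * Ly' / (ε * μy ^ 4)) + √(B * ρxy * Ly' / (ε * μy ^ 3)))
                  * √(deltaCSC f g xs μy ε))
                * Real.log (logArg f g xs Ly' ρxy ρyy μy ε) ^ 2) := by
  -- The estimates above assume `1 ≤ ℓ`; passing to `max ℓ 1` costs nothing, since `ℓ` is only an
  -- upper bound.
  have hℓ : 1 ≤ max ℓ 1 := le_max_right _ _
  have hlogℓ : 0 ≤ Real.log (max ℓ 1) / Real.log 2 :=
    div_nonneg (Real.log_nonneg hℓ) (Real.log_nonneg (by norm_num))
  refine ⟨(τ + 1) * 1000000 * max ℓ 1 ^ 2 * (1 + Real.log (max ℓ 1) / Real.log 2) ^ 2,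
    by positivity, ?_⟩
  intro p q hq f g Lx Lxy Ly Lxy' Ly' ρxy ρyy μy h hLx hLxy hLy hLxy' hμy xs B hxs hB hB0 ε hε
  have : Nonempty (Fin q) := ⟨⟨0, hq⟩⟩
  have hle : ∀ {a : ℝ}, a ≤ ℓ → a ≤ max ℓ 1 := fun ha => ha.trans (le_max_left _ _)
  exact ⟨h.suboptimality_complexity hxs hε hB hB0 hℓ (hle hLx) (hle hLxy) (hle hLy) (hle hLxy')
      (hle hμy) hτ.le,
    h.differentiable_bilevelObj,
    h.gradient_complexity hxs hε hB hB0 hℓ (hle hLx) (hle hLxy) (hle hLy) (hle hLxy')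
      (hle hμy) hτ.le⟩
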